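/- Let $G$ be a compact simply connected Lie group and $H\subset G$ a closed connected subgroup, with Lie algebras $\mathfrak g,\mathfrak h$, such that $G/H$ is a Hermitian symmetric space: there are a decomposition $\mathfrak g=\mathfrak h\oplus\mathfrak m$ with $[\mathfrak h,\mathfrak m]\subset\mathfrak m$, $[\mathfrak m,\mathfrak m]\subset\mathfrak h$, an $\mathrm{ad}(\mathfrak h)$-invariant symplectic form $\omega_0$ on $\mathfrak m$, and a complex structure $J_0$ on $\mathfrak m$, invariant under the isotropy representation $\kappa=\mathrm{Ad}|_H:H\to\mathrm{Sp}(\mathfrak m)$, such that $\omega_0(X,J_0Y)$ is an inner product. Let $(X_1,\dots,X_{2n})$ be a unitary basis of $\mathfrak m$, i.e. $\omega_0(X_j,X_k)=\omega_0(X_{n+j},X_{n+k})=0$, $\omega_0(X_j,X_{n+k})=\delta_{jk}$ and $J_0X_j=X_{n+j}$ for $1\le j,k\le n$; it identifies $\mathrm{Sp}(\mathfrak m)$ with $\mathrm{Sp}(n,\mathbb R)$. Let a metaplectic structure be given by a lift $\tilde\kappa:H\to\mathrm{Mp}(n,\mathbb R)$ of $\kappa$ to the connected double cover, and let $\lambda=\boldsymbol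 m\circ\tilde\kappa$, where $\boldsymbol m$ is the metaplectic representation on $L^2(\mathbb R^n)$. The symplectic spinor fields $\Gamma(Q)$, $Q=G\times_\lambda L^2(\mathbb R^n)$, are the smooth maps $\varphi:G\to L^2(\mathbb R^n)$ with $\varphi(gh)=\lambda(h^{-1})\varphi(g)$ for $g\in G$, $h\in H$. Symplectic Clifford multiplication is the linear extension of $X_j\cdot f=\mathrm i x_jf$, $X_{n+j}\cdot f=\partial f/\partial x_j$ ($1\le j\le n$), regarded as unbounded operators on $L^2(\mathbb R^n)$ (with the products formed in the sense of tempered distributions). Writing $\mu$ for this multiplication, $\bar\omega:\mathfrak m^*\to\mathfrak m$ for the isomorphism with $\omega_0(\bar\omega(\alpha),Y)=\alpha(Y)$, and $(\nabla\varphi)(g)\in\mathfrak m^*\otimes L^2(\mathbb R^n)$ for the derivative of $\varphi$ along the left-invariant vector fields determined by the elements of $\mathfrak m$, the first symplectic Dirac operator is the (partially defined) operator $\mathcal D=\mu\circ(\bar\omega\otimes\mathrm{id})\circ\nabla$ on $\Gamma(Q)$. For $l\ge0$ let $W_l\subset L^2(\mathbb R^n)$ be the span of the Hermite functions $\boldsymbol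 h_\alpha(x)=\prod_j\boldsymbol h_{\alpha_j}(x_j)$ with $\alpha_1+\dots+\alpha_n=l$, where $\boldsymbol h_k(t)=\mathrm e^{t^2/2}\frac{\mathrm d^k}{\mathrm dt^k}\mathrm e^{-t^2}$, and let $W_{-1}=0$. Let $\tau:G\to\mathrm{GL}(V)$ be an irreducible finite-dimensional complex representation of $G$ with differential $\tau_*$. Let $\mathrm{Hom}_H(V,W_l)$ be the space of linear maps $L:V\to W_l$ with $L\circ\tau(h)=\lambda(h)\circ L$ for all $h\in H$, and let $U=\sum_{l\ge0}\mathrm{Hom}_H(V,W_l)$. Then the sum $U=\bigoplus_{l\ge0}\mathrm{Hom}_H(V,W_l)$ is direct; the linear map $V\otimes U\to\Gamma(Q)$ that sends $v\otimes L$ to the field $g\mapsto L(\tau(g^{-1})v)$ is injective; and there is a linear map $\mathcal D_V:U\to U$ with $$\mathcal D_V(L)=-\sum_{j=1}^nX_j\cdot L\circ\tau_*(X_{n+j})+\sum_{j=1}^nX_{n+j}\cdot L\circ\tau_*(X_j)\qquad(L\in U),$$ which maps $\mathrm{Hom}_H(V,W_l)$ into $\mathrm{Hom}_H(V,W_{l-1})\oplus\mathrm{Hom}_H(V,W_{l+1})$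 for every $l\ge0$. The image of $V\otimes U$ in $\Gamma(Q)$ lies in the domain of $\mathcal D$ and is invariant under $\mathcal D$, and on it $\mathcal D$ acts as $\mathrm{id}\otimes\mathcal D_V$. -/

import Mathlib

open scoped Manifold ContDiff SchwartzMap LineDeriv TensorProduct Matrix ENNReal
open MeasureTheory

noncomputable section

namespace SympDirac

/-! ### The Hilbert space `L²(ℝⁿ)`, Weyl operators and the metaplectic group -/

/-- The Hilbert space `L²(ℝⁿ)` of complex-valued functions. -/
abbrev L2 (n : ℕ) : Type := Lp ℂ 2 (volume : Measure (EuclideanSpace ℝ (Fin n)))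

/-- The tempered distributions on `ℝⁿ`; they contain `L²(ℝⁿ)`. -/
abbrev Distr (n : ℕ) : Type := 𝓢'(EuclideanSpace ℝ (Fin n), ℂ)

/-- The inclusion of `L²(ℝⁿ)` into the tempered distributions. -/
def toDistr (n : ℕ) : L2 n →ₗ[ℂ] Distr n :=
  (Lp.toTemperedDistributionCLM (E := EuclideanSpace ℝ (Fin n)) ℂ volume 2).toLinearMap

theorem toDistr_injective (n : ℕ) : Function.Injective (toDistr n) := by
  have h := Lp.ker_toTemperedDistributionCLM_eq_bot (E := EuclideanSpace ℝ (Fin n)) (F := ℂ)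
    (μ := volume) (p := 2)
  exact LinearMap.ker_eq_bot.mp h

/-- The second half `q` of a vector `z = (p, q)` of `ℝ²ⁿ`, as a point of `ℝⁿ`. -/
def qPart {n : ℕ} (z : Fin n ⊕ Fin n → ℝ) : EuclideanSpace ℝ (Fin n) :=
  WithLp.toLp 2 fun j => z (Sum.inr j)

/-- The phase `exp (i p·x + (i/2) p·q)`. -/
def weylPhase {n : ℕ} (z : Fin n ⊕ Fin n → ℝ) (x : EuclideanSpace ℝ (Fin n)) : ℂ :=
  Complex.exp (((∑ j, z (Sum.inl j) * x j + (∑ j, z (Sum.inl j) * z (Sum.inr j)) / 2 : ℝ) : ℂ)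
    * Complex.I)

theorem memLp_weyl {n : ℕ} (z : Fin n ⊕ Fin n → ℝ) (f : L2 n) :
    MemLp (fun x => weylPhase z x * f (x + qPart z)) 2 volume := by
  have h1 : MemLp (fun x => f (x + qPart z)) 2 volume :=
    (Lp.memLp f).comp_measurePreserving (measurePreserving_add_right volume (qPart z))
  have h2 : Continuous (weylPhase z) := by
    unfold weylPhase
    fun_prop
  refine h1.of_le (h2.aestronglyMeasurable.mul h1.1) (Filter.Eventually.of_forall fun x => ?_)
  rw [norm_mul, weylPhase, Complex.norm_exp_ofReal_mul_I, one_mul]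

/-- The Weyl operator `W(z) = exp (i p·x + q·∂)` on `L²(ℝⁿ)` for `z = (p, q)`, that is
`(W(z) f)(x) = exp (i p·x + (i/2) p·q) f(x + q)`. These operators are the Schrödinger
representation of the Heisenberg group; `t ↦ W(t z)` is generated by the symplectic Clifford
multiplication with the vector of coordinates `z`. -/
def weyl {n : ℕ} (z : Fin n ⊕ Fin n → ℝ) (f : L2 n) : L2 n := (memLp_weyl z f).toLp _

/-- The symplectic group `Sp(n, ℝ)`. -/
abbrev Sp (n : ℕ) : Type := Matrix.symplecticGroup (Fin n) ℝ

/-- The unitary group of `L²(ℝⁿ)`. -/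
abbrev U2 (n : ℕ) : Type := L2 n ≃ₗᵢ[ℂ] L2 n

/-- The group of all pairs `(A, U)` of a symplectic matrix and a unitary operator with
`U W(z) U⁻¹ = W(A z)` for all `z`. By the Stone-von Neumann theorem this is a central extension
of `Sp(n, ℝ)` by the circle group (the group `Mpᶜ(n)`). -/
def Mpc (n : ℕ) : Subgroup (Sp n × U2 n) where
  carrier := {a | ∀ (z : Fin n ⊕ Fin n → ℝ) (f : L2 n),
    a.2 (weyl z f) = weyl (a.1.1 *ᵥ z) (a.2 f)}
  one_mem' := by
    intro z f
    simp
  mul_mem' := by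
    intro a b ha hb z f
    have h1 : (a * b).2 (weyl z f) = a.2 (b.2 (weyl z f)) := rfl
    have h2 : (a * b).2 f = a.2 (b.2 f) := rfl
    have h3 : (a * b).1.1 = a.1.1 * b.1.1 := rfl
    rw [h1, h2, h3, hb, ha, Matrix.mulVec_mulVec]
  inv_mem' := by
    intro a ha z f
    have h := ha ((a⁻¹).1.1 *ᵥ z) ((a⁻¹).2 f)
    have h1 : a.2 ((a⁻¹).2 f) = f := a.2.apply_symm_apply f
    have h2 : a.1.1 * (a⁻¹).1.1 = 1 := congrArg Subtype.val (mul_inv_cancel a.1)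
    rw [h1, Matrix.mulVec_mulVec, h2, Matrix.one_mulVec] at h
    rw [← h]
    exact a.2.symm_apply_apply _

/-- The metaplectic group `Mp(n, ℝ)`, the connected double cover of `Sp(n, ℝ)`, realised inside
`Sp(n, ℝ) × U(L²(ℝⁿ))`. Since `Mpᶜ(n) = Mp(n, ℝ) · U(1)` with `U(1)` central and `Mp(n, ℝ)` is
perfect, it is the commutator subgroup of `Mpᶜ(n)`. -/
def Mp (n : ℕ) : Subgroup (Sp n × U2 n) := ⁅Mpc n, Mpc n⁆

/-- The covering homomorphism `ρ : Mp(n, ℝ) → Sp(n, ℝ)`. -/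
def rho (n : ℕ) : Mp n →* Sp n := (MonoidHom.fst (Sp n) (U2 n)).comp (Mp n).subtype

/-- The metaplectic representation of `Mp(n, ℝ)` on `L²(ℝⁿ)`. -/
def metaplectic (n : ℕ) : Mp n →* U2 n := (MonoidHom.snd (Sp n) (U2 n)).comp (Mp n).subtype

/-! ### Hermite functions and Clifford multiplication in coordinates -/

/-- The classical Hermite functions `h_l(t) = exp (t²/2) (d/dt)^l exp (-t²)`. -/
def hermiteFn (l : ℕ) (t : ℝ) : ℝ :=
  Real.exp (t ^ 2 / 2) * iteratedDeriv l (fun s : ℝ => Real.exp (-s ^ 2)) t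

/-- The Hermite function `h_α` on `ℝⁿ` for a multi-index `α`. -/
def hermiteFnMulti {n : ℕ} (α : Fin n → ℕ) (x : EuclideanSpace ℝ (Fin n)) : ℂ :=
  ((∏ j, hermiteFn (α j) (x j) : ℝ) : ℂ)

/-- The span `W_l` of the Hermite functions `h_α` with `|α| = l` in `L²(ℝⁿ)`. The degree is an
integer, so that `W_l = 0` for negative `l`. -/
def hermiteSpan (n : ℕ) (l : ℤ) : Submodule ℂ (L2 n) :=
  Submodule.span ℂ {f | ∃ α : Fin n → ℕ, ((∑ j, α j : ℕ) : ℤ) = l ∧ f =ᵐ[volume] hermiteFnMulti α}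

/-- Clifford multiplication on `L²(ℝⁿ)` by the basis vectors: `X_j · f = i x_j f` (left summand)
and `X_{n+j} · f = ∂f/∂x_j` (right summand). As these are unbounded operators on `L²(ℝⁿ)`, the
result is taken in the tempered distributions; `X · f = g` holds in `L²(ℝⁿ)` if the distribution
`X · f` is given by `g`. -/
def cliffBasis (n : ℕ) : Fin n ⊕ Fin n → (L2 n →ₗ[ℂ] Distr n)
  | Sum.inl j =>
      (TemperedDistribution.smulLeftCLM ℂ
        (fun x : EuclideanSpace ℝ (Fin n) => Complex.I * (x j : ℂ))).toLinearMap ∘ₗ toDistr n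
  | Sum.inr j =>
      (LineDeriv.lineDerivOpCLM ℂ (Distr n)
        (EuclideanSpace.single j (1 : ℝ) : EuclideanSpace ℝ (Fin n))).toLinearMap ∘ₗ toDistr n

/-! ### Lie groups: adjoint representation, Lie algebra of a subgroup -/

section Lie

variable {E : Type*} [NormedAddCommGroup E] [NormedSpace ℝ E]
  {G : Type*} [TopologicalSpace G] [ChartedSpace E G] [Group G]

variable (E) in
/-- The adjoint representation: the differential at the unit element of `x ↦ g x g⁻¹`. -/
def Ad (g : G) (X : GroupLieAlgebra 𝓘(ℝ, E) G) : GroupLieAlgebra 𝓘(ℝ, E) G :=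
  (mfderiv 𝓘(ℝ, E) 𝓘(ℝ, E) (fun x : G => g * x * g⁻¹) 1 X : E)

variable (E) in
/-- The Lie algebra of a closed subgroup `H` of a Lie group: the initial velocities of the
one-parameter subgroups of `G` that lie in `H` (for closed `H` these already form a subspace). -/
def lieAlgOf (H : Subgroup G) : Submodule ℝ (GroupLieAlgebra 𝓘(ℝ, E) G) :=
  Submodule.span ℝ {X | ∃ γ : ℝ → G, ContMDiff 𝓘(ℝ, ℝ) 𝓘(ℝ, E) ∞ γ ∧
    (∀ s t, γ (s + t) = γ s * γ t) ∧ (∀ t, γ t ∈ H) ∧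
    (mfderiv 𝓘(ℝ, ℝ) 𝓘(ℝ, E) γ 0 (1 : ℝ) : E) = X}

variable (E) in
/-- The differential `τ_*` of a finite-dimensional representation `τ` of `G`:
`τ_*(X) v` is the derivative of `g ↦ τ(g) v` at the unit element in the direction `X`. -/
def dRep {V : Type*} [NormedAddCommGroup V] [NormedSpace ℂ V] (τ : Representation ℂ G V)
    (X : GroupLieAlgebra 𝓘(ℝ, E) G) (v : V) : V :=
  mfderiv 𝓘(ℝ, E) 𝓘(ℝ, V) (fun g : G => τ g v) 1 X

end Lie

/-! ### Hermitian symmetric spaces -/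

/-- The data that make `G/H` a (simply connected) Hermitian symmetric space with an adapted
unitary basis. The group `G` is a Lie group modelled on `E`. -/
structure HermitianSymmetric (E : Type*) [NormedAddCommGroup E] [NormedSpace ℝ E]
    (G : Type*) [TopologicalSpace G] [ChartedSpace E G] [Group G] (n : ℕ) where
  /-- the isotropy group -/
  H : Subgroup G
  isClosed_H : IsClosed (H : Set G)
  isConnected_H : IsConnected (H : Set G)
  /-- the complement of the Lie algebra `𝔥` of `H` in `𝔤`, identified with the tangent space of
  `G/H` at the base point -/
  m : Submodule ℝ (GroupLieAlgebra 𝓘(ℝ, E) G)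
  isCompl : IsCompl (lieAlgOf E H) m
  lie_h_m : ∀ X ∈ lieAlgOf E H, ∀ Y ∈ m, ⁅X, Y⁆ ∈ m
  lie_m_m : ∀ X ∈ m, ∀ Y ∈ m, ⁅X, Y⁆ ∈ lieAlgOf E H
  /-- the symplectic form on `m` -/
  ω₀ : LinearMap.BilinForm ℝ m
  ω₀_alt : ω₀.IsAlt
  ω₀_nondegenerate : ω₀.Nondegenerate
  /-- `ω₀` is `ad(𝔥)`-invariant -/
  ω₀_invariant : ∀ X (hX : X ∈ lieAlgOf E H) (Y Z : m),
    ω₀ ⟨⁅X, (Y : GroupLieAlgebra 𝓘(ℝ, E) G)⁆, lie_h_m X hX Y Y.2⟩ Z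
      + ω₀ Y ⟨⁅X, (Z : GroupLieAlgebra 𝓘(ℝ, E) G)⁆, lie_h_m X hX Z Z.2⟩ = 0
  /-- the complex structure on `m` -/
  J₀ : m →ₗ[ℝ] m
  J₀_sq : ∀ Y, J₀ (J₀ Y) = -Y
  /-- the almost complex structure on `G/H` induced by `J₀` is `G`-invariant, i.e. `J₀` commutes
  with the isotropy representation, the restriction of `Ad` to `H` and `m` -/
  J₀_invariant : ∀ h ∈ H, ∀ Y Y' : m, (Y' : GroupLieAlgebra 𝓘(ℝ, E) G) = Ad E h Y →
    (J₀ Y' : GroupLieAlgebra 𝓘(ℝ, E) G) = Ad E h (J₀ Y)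
  /-- `g₀(X, Y) = ω₀(X, J₀ Y)` is an inner product -/
  g₀_symm : ∀ X Y, ω₀ X (J₀ Y) = ω₀ Y (J₀ X)
  g₀_pos : ∀ X, X ≠ 0 → 0 < ω₀ X (J₀ X)
  /-- a basis `X_1, …, X_n, X_{n+1}, …, X_{2n}` of `m` -/
  X : Module.Basis (Fin n ⊕ Fin n) ℝ m
  /-- the basis is symplectic -/
  ω₀_inl_inl : ∀ j k, ω₀ (X (Sum.inl j)) (X (Sum.inl k)) = 0
  ω₀_inr_inr : ∀ j k, ω₀ (X (Sum.inr j)) (X (Sum.inr k)) = 0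
  ω₀_inl_inr : ∀ j k, ω₀ (X (Sum.inl j)) (X (Sum.inr k)) = if j = k then 1 else 0
  /-- the basis is unitary -/
  J₀_X : ∀ j, J₀ (X (Sum.inl j)) = X (Sum.inr j)

namespace HermitianSymmetric

variable {E : Type*} [NormedAddCommGroup E] [NormedSpace ℝ E]
  {G : Type*} [TopologicalSpace G] [ChartedSpace E G] [Group G] {n : ℕ}
  (S : HermitianSymmetric E G n)

/-- A lift of the isotropy representation `κ = Ad|_H : H → Sp(m)` to the metaplectic group, where
`Sp(m)` is identified with `Sp(n, ℝ)` by the basis of `m`. It determines the metaplectic structure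
of `G/H`. Continuity refers to the strong operator topology (the component in `Sp(n, ℝ)` is `κ`). -/
structure Lift where
  /-- the lift `κ̃ : H → Mp(n, ℝ)` -/
  hom : S.H →* Mp n
  continuous_hom : ∀ f : L2 n, Continuous fun h : S.H => metaplectic n (hom h) f
  /-- `ρ ∘ κ̃ = κ` -/
  rho_hom : ∀ (h : S.H) (z : Fin n ⊕ Fin n → ℝ),
    ((S.X.equivFun.symm ((rho n (hom h)).1 *ᵥ z) : S.m) : GroupLieAlgebra 𝓘(ℝ, E) G)
      = Ad E (h : G) (S.X.equivFun.symm z : S.m)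

variable {S} in
/-- The unitary representation `λ` of `H` on `L²(ℝⁿ)`, the composition of the metaplectic
representation with the lift. -/
def Lift.lam (κ : S.Lift) : S.H →* U2 n := (metaplectic n).comp κ.hom

variable {S} in
/-- The symplectic spinor fields `Γ(Q)`, `Q = G ×_λ L²(ℝⁿ)`: the smooth maps `φ : G → L²(ℝⁿ)` with
`φ(g h) = λ(h⁻¹) φ(g)` for `g ∈ G`, `h ∈ H`. -/
def Lift.spinorFields (κ : S.Lift) : Submodule ℂ (G → L2 n) where
  carrier := {φ | ContMDiff 𝓘(ℝ, E) 𝓘(ℝ, L2 n) ∞ φ ∧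
    ∀ (g : G) (h : S.H), φ (g * h) = κ.lam h⁻¹ (φ g)}
  zero_mem' := ⟨contMDiff_const, fun g h => by simp⟩
  add_mem' := fun {a b} ha hb => ⟨ha.1.add hb.1, fun g h => by simp [ha.2, hb.2]⟩
  smul_mem' := fun c a ha => by
    refine ⟨?_, fun g h => by simp [ha.2]⟩
    have hc : ContDiff ℝ ∞ (fun f : L2 n => c • f) := contDiff_id.const_smul c
    exact hc.contMDiff.comp ha.1

/-- The spinor derivative of `φ` at `g`: the map sending `Y ∈ m` to the derivative of `φ` at `g` in
the direction of the left-invariant vector field determined by `Y`. -/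
def nabla (φ : G → L2 n) (g : G) : S.m →ₗ[ℝ] L2 n where
  toFun Y := mfderiv 𝓘(ℝ, E) 𝓘(ℝ, L2 n) φ g
    (mulInvariantVectorField (Y : GroupLieAlgebra 𝓘(ℝ, E) G) g)
  map_add' Y Z := by simp [mulInvariantVectorField_add]; rfl
  map_smul' c Y := by simp [mulInvariantVectorField_smul]; rfl

/-- The symplectic Clifford multiplication `m × L²(ℝⁿ) → 𝓢'(ℝⁿ)`. -/
def cliff : S.m →ₗ[ℝ] L2 n →ₗ[ℝ] Distr n :=
  S.X.constr ℝ fun j => (cliffBasis n j).restrictScalars ℝ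

/-- The isomorphism `m* ≃ m` given by the symplectic form: `ω₀(ω̄(α), Y) = α(Y)`. -/
def omegaBar : Module.Dual ℝ S.m ≃ₗ[ℝ] S.m :=
  haveI : FiniteDimensional ℝ S.m := S.X.finiteDimensional_of_finite
  (S.ω₀.toDual S.ω₀_nondegenerate).symm

/-- The first symplectic Dirac operator `D = μ ∘ (ω̄ ⊗ id) ∘ ∇`, with values in the tempered
distributions: `∇φ(g) ∈ Hom(m, L²(ℝⁿ)) = m* ⊗ L²(ℝⁿ)` is sent by `ω̄ ⊗ id` to `m ⊗ L²(ℝⁿ)` and then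
by Clifford multiplication to `𝓢'(ℝⁿ)`. -/
def diracDistr (φ : G → L2 n) (g : G) : Distr n :=
  haveI : FiniteDimensional ℝ S.m := S.X.finiteDimensional_of_finite
  TensorProduct.lift S.cliff
    (LinearMap.rTensor (L2 n) S.omegaBar.toLinearMap
      ((dualTensorHomEquiv ℝ S.m (L2 n)).symm (S.nabla φ g)))

variable {S} in
/-- `Dφ = ψ` for the first symplectic Dirac operator `D` as an (unbounded, partially defined)
operator on the symplectic spinor fields: the field `φ` lies in the domain of `D` and is mapped
to the field `ψ`. -/
def Lift.IsDirac (κ : S.Lift) (φ ψ : κ.spinorFields) : Prop :=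
  ∀ g : G, S.diracDistr φ.1 g = toDistr n (ψ.1 g)

variable {S} in
/-- The value of the Dirac operator is unique. -/
theorem Lift.IsDirac.unique {κ : S.Lift} {φ ψ ψ' : κ.spinorFields}
    (h : κ.IsDirac φ ψ) (h' : κ.IsDirac φ ψ') : ψ = ψ' :=
  Subtype.ext (funext fun g => toDistr_injective n ((h g).symm.trans (h' g)))

/-! ### The spaces `Hom_H(V, W_l)` and `U` for a representation `V` of `G` -/

variable {V : Type*} [NormedAddCommGroup V] [NormedSpace ℂ V]

variable {S} in
/-- `Hom_H(V, W_l)`: the `H`-equivariant linear maps from `V` to `W_l ⊆ L²(ℝⁿ)`. -/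
def Lift.homH (κ : S.Lift) (τ : Representation ℂ G V) (l : ℤ) : Submodule ℂ (V →ₗ[ℂ] L2 n) where
  carrier := {L | (∀ v, L v ∈ hermiteSpan n l) ∧
    ∀ (h : S.H) (v : V), L (τ (h : G) v) = κ.lam h (L v)}
  zero_mem' := ⟨fun v => by simp, fun h v => by simp⟩
  add_mem' := fun {a b} ha hb =>
    ⟨fun v => (hermiteSpan n l).add_mem (ha.1 v) (hb.1 v), fun h v => by simp [ha.2, hb.2]⟩
  smul_mem' := fun c a ha =>
    ⟨fun v => (hermiteSpan n l).smul_mem c (ha.1 v), fun h v => by simp [ha.2]⟩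

variable {S} in
/-- `U = ∑_{l ≥ 0} Hom_H(V, W_l)`, as a space of linear maps from `V` to `L²(ℝⁿ)`. -/
def Lift.homSum (κ : S.Lift) (τ : Representation ℂ G V) : Submodule ℂ (V →ₗ[ℂ] L2 n) :=
  ⨆ l : ℕ, κ.homH τ (l : ℤ)

variable {S} in
theorem Lift.homSum_equivariant (κ : S.Lift) (τ : Representation ℂ G V)
    {L : V →ₗ[ℂ] L2 n} (hL : L ∈ κ.homSum τ) (h : S.H) (v : V) :
    L (τ (h : G) v) = κ.lam h (L v) := by
  induction hL using Submodule.iSup_induction' with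
  | mem l x hx => exact hx.2 h v
  | zero => simp
  | add x y _ _ hx hy => simp [hx, hy]

variable {S} in
theorem Lift.embed_mem [LieGroup 𝓘(ℝ, E) ∞ G] [FiniteDimensional ℂ V] (κ : S.Lift)
    (τ : Representation ℂ G V)
    (hτ : ∀ v, ContMDiff 𝓘(ℝ, E) 𝓘(ℝ, V) ∞ fun g : G => τ g v) (v : V) (L : κ.homSum τ) :
    (fun g : G => L.1 (τ g⁻¹ v)) ∈ κ.spinorFields := by
  constructor
  · have h1 : ContMDiff 𝓘(ℝ, E) 𝓘(ℝ, V) ∞ fun g : G => τ g⁻¹ v :=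
      (hτ v).comp (contMDiff_inv 𝓘(ℝ, E) ∞)
    have h2 : ContDiff ℝ ∞ (fun w : V => L.1 w) :=
      ((LinearMap.toContinuousLinearMap L.1).restrictScalars ℝ).contDiff
    exact h2.contMDiff.comp h1
  · intro g h
    have h1 : (g * (h : G))⁻¹ = ((h⁻¹ : S.H) : G) * g⁻¹ := by simp
    have h2 : τ (g * (h : G))⁻¹ v = τ ((h⁻¹ : S.H) : G) (τ g⁻¹ v) := by
      rw [h1, map_mul]; rfl
    change L.1 (τ (g * (h : G))⁻¹ v) = _
    rw [h2, κ.homSum_equivariant τ L.2]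

variable {S} in
/-- The embedding of `V ⊗ U` into the symplectic spinor fields, sending `v ⊗ L` to the field
`g ↦ L(τ(g⁻¹) v)`. -/
def Lift.embed [LieGroup 𝓘(ℝ, E) ∞ G] [FiniteDimensional ℂ V] (κ : S.Lift)
    (τ : Representation ℂ G V)
    (hτ : ∀ v, ContMDiff 𝓘(ℝ, E) 𝓘(ℝ, V) ∞ fun g : G => τ g v) :
    V ⊗[ℂ] κ.homSum τ →ₗ[ℂ] κ.spinorFields :=
  TensorProduct.lift (LinearMap.mk₂ ℂ
    (fun v L => (⟨fun g : G => L.1 (τ g⁻¹ v), κ.embed_mem τ hτ v L⟩ : κ.spinorFields))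
    (fun v w L => by ext1; funext g; simp)
    (fun c v L => by ext1; funext g; simp)
    (fun v L M => by ext1; funext g; simp)
    (fun c v L => by ext1; funext g; simp))

end HermitianSymmetric

end SympDirac

end

noncomputable section

namespace SympDirac

/-! The field of `v ⊗ L` depends on `g` only through `τ(g⁻¹)v`, so its derivative along `Y` is
`-L(τ_*(Y) τ(g⁻¹)v)` (`nabla_embed`). Expanding `∇` in the dual basis (`diracDistr_eq`) turns `D`
into the formula for `D_V`; what remains is algebra on Hermite functions. These are Schwartz
functions, on which Clifford multiplication can be iterated.

`D_V` preserves `U` for three reasons. The Hermite recursions show that each `X_a` shifts the degree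
by one (`cliffSchwartz_mem`). Differentiating `U W(tz) = W(tAz) U` at `t = 0` shows that `λ(h)`
transforms Clifford multiplication by the same matrix `A` by which `Ad(h)` acts on `m`; since `D_V`
is the contraction of `X_a · L ∘ τ_*(X_b)` with `J` and `A J Aᵀ = J`, it preserves equivariance
(`Lift.diracSchwartz_mem_schwartzHom`). Finally the parts of degree `l - 1` and `l + 1` are
separately equivariant: they are cut out by the harmonic oscillator `-∑ X_a²`, which commutes with
`λ(h)` because `A`, being symplectic and commuting with `J`, is orthogonal (`Mpc_oscillator`,
`upperPart_mem`).

The oscillator has eigenvalue `2l + n` in degree `l`, so the sum over `l` is direct. Injectivity is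
Burnside's theorem: if `∑ L_i(τ(g) b_i) = 0` for all `g`, then `τ(g)` may be replaced by any
endomorphism, and rank-one endomorphisms give `L_i = 0`. -/

/-! ### Hermite functions as Schwartz functions -/

/-- The polynomials `q_k` with `(d/dt)^k exp (-t²) = q_k(t) exp (-t²)`. -/
def hermitePoly : ℕ → Polynomial ℝ
  | 0 => 1
  | k + 1 => Polynomial.derivative (hermitePoly k) - 2 * Polynomial.X * hermitePoly k

theorem iteratedDeriv_exp_neg_sq (k : ℕ) :
    iteratedDeriv k (fun s : ℝ => Real.exp (-s ^ 2)) =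
      fun s => (hermitePoly k).eval s * Real.exp (-s ^ 2) := by
  induction k with
  | zero => ext s; simp [hermitePoly]
  | succ k ih =>
    rw [iteratedDeriv_succ, ih]
    ext s
    have h1 : HasDerivAt (fun s : ℝ => Real.exp (-s ^ 2)) (Real.exp (-s ^ 2) * (-(2 * s))) s := by
      simpa using ((hasDerivAt_pow 2 s).neg).exp
    have h2 := ((Polynomial.hasDerivAt (hermitePoly k) s).mul h1).deriv
    simp only [Pi.mul_def] at h2
    rw [h2]
    simp [hermitePoly]
    ring

/-- Induction, differentiating the defining recursion. The truncated index at `k = 0` is harmless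
because the factor `k` vanishes. -/
theorem derivative_hermitePoly (k : ℕ) :
    Polynomial.derivative (hermitePoly k) =
      Polynomial.C (-2 * (k : ℝ)) * hermitePoly (k - 1) := by
  induction k with
  | zero => simp [hermitePoly]
  | succ k ih =>
    rw [hermitePoly, Polynomial.derivative_sub, ih, Polynomial.derivative_C_mul,
      Polynomial.derivative_mul, ih]
    rcases k with _ | k
    · simp [hermitePoly, map_ofNat]
    · simp only [Nat.add_sub_cancel, hermitePoly]
      simp only [map_mul, map_neg, map_ofNat, Nat.cast_add, Nat.cast_one, map_add, map_one,
        map_natCast, Polynomial.derivative_mul, Polynomial.derivative_ofNat,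
        Polynomial.derivative_X]
      ring

theorem hermiteFn_eq (k : ℕ) (t : ℝ) :
    hermiteFn k t = (hermitePoly k).eval t * Real.exp (-t ^ 2 / 2) := by
  have h : Real.exp (-t ^ 2 / 2) = Real.exp (t ^ 2 / 2) * Real.exp (-t ^ 2) := by
    rw [← Real.exp_add]
    congr 1
    ring
  rw [hermiteFn, iteratedDeriv_exp_neg_sq, h]
  ring

/-- The defining recursion with `q_k' = -2k q_{k-1}` inserted, solved for `t q_k`. -/
theorem mul_hermiteFn (k : ℕ) (t : ℝ) :
    t * hermiteFn k t = -(hermiteFn (k + 1) t + 2 * k * hermiteFn (k - 1) t) / 2 := by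
  simp only [hermiteFn_eq, hermitePoly, derivative_hermitePoly k]
  simp
  ring

theorem hasDerivAt_hermiteFn (k : ℕ) (t : ℝ) :
    HasDerivAt (hermiteFn k) ((hermiteFn (k + 1) t - 2 * k * hermiteFn (k - 1) t) / 2) t := by
  have h1 : HasDerivAt (fun s : ℝ => Real.exp (-s ^ 2 / 2)) (Real.exp (-t ^ 2 / 2) * (-t)) t := by
    have := ((hasDerivAt_pow 2 t).neg.div_const 2).exp
    convert! this using 2
    simp
    ring
  have h2 := (Polynomial.hasDerivAt (hermitePoly k) t).mul h1
  have h3 : hermiteFn k = fun s => (hermitePoly k).eval s * Real.exp (-s ^ 2 / 2) :=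
    funext (hermiteFn_eq k)
  rw [h3]
  convert! h2 using 1
  simp only [hermiteFn_eq, hermitePoly, derivative_hermitePoly k]
  simp
  ring

/-- One term of the exponential series gives `(1 + r)^N ≤ N! exp(1 + r)`, and `1 + r - r²/2 = 3/2 -
(r - 1)²/2`. -/
theorem one_add_pow_mul_exp_le (N : ℕ) {r : ℝ} (hr : 0 ≤ r) :
    (1 + r) ^ N * Real.exp (-r ^ 2 / 2) ≤ N.factorial * Real.exp (3 / 2) := by
  have h1 := Real.pow_div_factorial_le_exp (1 + r) (by positivity) N
  rw [div_le_iff₀ (by positivity)] at h1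
  have h2 : Real.exp (1 + r) * Real.exp (-r ^ 2 / 2) ≤ Real.exp (3 / 2) := by
    rw [← Real.exp_add]
    exact Real.exp_le_exp.mpr (by nlinarith [sq_nonneg (r - 1)])
  calc (1 + r) ^ N * Real.exp (-r ^ 2 / 2)
      ≤ Real.exp (1 + r) * N.factorial * Real.exp (-r ^ 2 / 2) := by gcongr
    _ = N.factorial * (Real.exp (1 + r) * Real.exp (-r ^ 2 / 2)) := by ring
    _ ≤ _ := by gcongr

theorem norm_iteratedFDeriv_ofReal_exp (i : ℕ) (s : ℝ) :
    ‖iteratedFDeriv ℝ i (fun s : ℝ => (Real.exp s : ℂ)) s‖ = Real.exp s := by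
  have h := Complex.ofRealLI.norm_iteratedFDeriv_comp_left (f := Real.exp) (x := s)
    (Real.contDiff_exp.contDiffAt (n := ∞)) (i := i) (by exact_mod_cast le_top)
  have h2 : (Complex.ofRealLI ∘ Real.exp) = fun s : ℝ => (Real.exp s : ℂ) := rfl
  rw [h2] at h
  rw [h, norm_iteratedFDeriv_eq_norm_iteratedDeriv, iteratedDeriv_eq_iterate, Real.iter_deriv_exp,
    Real.norm_eq_abs, Real.abs_exp]

/-- The Gaussian `exp (-‖x‖²/2)` as a Schwartz function. -/
def gaussianSchwartz (F : Type*) [NormedAddCommGroup F] [InnerProductSpace ℝ F] : 𝓢(F, ℂ) where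
  toFun x := (Real.exp (-‖x‖ ^ 2 / 2) : ℂ)
  smooth' := by
    have h1 : ContDiff ℝ ∞ fun x : F => Real.exp (-‖x‖ ^ 2 / 2) :=
      (((contDiff_norm_sq ℝ).neg).div_const 2).exp
    exact Complex.ofRealCLM.contDiff.comp h1
  decay' := by
    intro k n
    have hT : Function.HasTemperateGrowth fun x : F => -‖x‖ ^ 2 / 2 := by
      have h1 := (Function.HasTemperateGrowth.const (E := F) (-(1 / 2 : ℝ))).mul
        (Function.hasTemperateGrowth_norm_sq F)
      have h2 : (fun x : F => -‖x‖ ^ 2 / 2) =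
          (fun _ : F => -(1 / 2 : ℝ)) * fun x : F => ‖x‖ ^ 2 := by
        ext x
        simp only [Pi.mul_apply]
        ring
      rwa [h2]
    obtain ⟨m, C, hC0, hC⟩ := hT.norm_iteratedFDeriv_le_uniform n
    refine ⟨n.factorial * (C + 1) ^ n * ((k + m * n).factorial * Real.exp (3 / 2)), fun x => ?_⟩
    -- The Faà di Bruno bound needs the `i`-th derivative below an `i`-th power. Taking `C + 1`
    -- makes the base at least `1`, so it can be raised to the power `i`.
    have hD : ∀ i, 1 ≤ i → i ≤ n → ‖iteratedFDeriv ℝ i (fun x : F => -‖x‖ ^ 2 / 2) x‖ ≤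
        ((C + 1) * (1 + ‖x‖) ^ m) ^ i := by
      intro i hi hin
      have h1 : 1 ≤ (C + 1) * (1 + ‖x‖) ^ m :=
        one_le_mul_of_one_le_of_one_le (by linarith)
          (one_le_pow₀ (by linarith [norm_nonneg x]))
      refine (hC i hin x).trans (le_trans ?_ (le_self_pow₀ h1 (by omega)))
      gcongr
      linarith
    have hmain := norm_iteratedFDeriv_comp_le (g := fun s : ℝ => (Real.exp s : ℂ))
      (N := ∞) (n := n) (Complex.ofRealCLM.contDiff.comp Real.contDiff_exp) hT.1
      (by exact_mod_cast le_top) x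
      (fun i _ => (norm_iteratedFDeriv_ofReal_exp i _).le) hD
    have hx : 0 ≤ ‖x‖ := norm_nonneg x
    calc ‖x‖ ^ k * ‖iteratedFDeriv ℝ n (fun x : F => (Real.exp (-‖x‖ ^ 2 / 2) : ℂ)) x‖
        ≤ (1 + ‖x‖) ^ k * (n.factorial * Real.exp (-‖x‖ ^ 2 / 2) *
          ((C + 1) * (1 + ‖x‖) ^ m) ^ n) := by
          gcongr
          · linarith
          · exact hmain
      _ = n.factorial * (C + 1) ^ n *
          ((1 + ‖x‖) ^ (k + m * n) * Real.exp (-‖x‖ ^ 2 / 2)) := by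
          rw [mul_pow, pow_add, pow_mul]; ring
      _ ≤ _ := by
          have := one_add_pow_mul_exp_le (k + m * n) hx
          gcongr

variable {n : ℕ}

theorem hasTemperateGrowth_coord (j : Fin n) :
    Function.HasTemperateGrowth (fun x : EuclideanSpace ℝ (Fin n) => x j) :=
  (EuclideanSpace.proj (𝕜 := ℝ) j).hasTemperateGrowth

theorem hasTemperateGrowth_polynomial_eval (p : Polynomial ℝ) (j : Fin n) :
    Function.HasTemperateGrowth (fun x : EuclideanSpace ℝ (Fin n) => p.eval (x j)) := by
  induction p using Polynomial.induction_on' with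
  | add p q hp hq => simpa using! hp.add hq
  | monomial k a =>
    simpa using! (Function.HasTemperateGrowth.const a).mul ((hasTemperateGrowth_coord j).pow k)

theorem hasTemperateGrowth_prod {ι : Type*} (s : Finset ι)
    (f : ι → EuclideanSpace ℝ (Fin n) → ℝ) (hf : ∀ i, (f i).HasTemperateGrowth) :
    Function.HasTemperateGrowth (fun x => ∏ i ∈ s, f i x) := by
  classical
  induction s using Finset.induction_on with
  | empty => exact Function.HasTemperateGrowth.const (1 : ℝ)
  | insert a s ha ih => simpa [Finset.prod_insert ha] using! (hf a).mul ih

/-- The Hermite function `h_α` on `ℝⁿ` as a Schwartz function. -/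
def hermiteSchwartz (α : Fin n → ℕ) : 𝓢(EuclideanSpace ℝ (Fin n), ℂ) :=
  SchwartzMap.smulLeftCLM ℂ
    (fun x : EuclideanSpace ℝ (Fin n) => ∏ j, (hermitePoly (α j)).eval (x j))
    (gaussianSchwartz (EuclideanSpace ℝ (Fin n)))

theorem hermiteSchwartz_apply (α : Fin n → ℕ) (x : EuclideanSpace ℝ (Fin n)) :
    hermiteSchwartz α x = hermiteFnMulti α x := by
  rw [hermiteSchwartz, SchwartzMap.smulLeftCLM_apply_apply
    (hasTemperateGrowth_prod _ _ fun j => hasTemperateGrowth_polynomial_eval _ j)]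
  simp only [hermiteFnMulti, hermiteFn_eq, Finset.prod_mul_distrib, ← Real.exp_sum]
  change (_ : ℝ) • ((Real.exp (-‖x‖ ^ 2 / 2) : ℝ) : ℂ) = _
  rw [Complex.real_smul, ← Complex.ofReal_mul, EuclideanSpace.real_norm_sq_eq, ← Finset.sum_div,
    Finset.sum_neg_distrib]

/-- The inclusion of the Schwartz functions into `L²(ℝⁿ)`. -/
def schwartzToL2 (n : ℕ) : 𝓢(EuclideanSpace ℝ (Fin n), ℂ) →ₗ[ℂ] L2 n :=
  (SchwartzMap.toLpCLM ℂ ℂ 2 (volume : Measure (EuclideanSpace ℝ (Fin n)))).toLinearMap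

theorem schwartzToL2_injective (n : ℕ) : Function.Injective (schwartzToL2 n) :=
  SchwartzMap.injective_toLp 2 (volume : Measure (EuclideanSpace ℝ (Fin n)))

theorem coeFn_schwartzToL2 (f : 𝓢(EuclideanSpace ℝ (Fin n), ℂ)) :
    schwartzToL2 n f =ᵐ[volume] f :=
  f.coeFn_toLp 2 volume

/-- The span of the Hermite functions of degree `l` in the Schwartz space. -/
def hermiteSchwartzSpan (n : ℕ) (l : ℤ) : Submodule ℂ 𝓢(EuclideanSpace ℝ (Fin n), ℂ) :=
  Submodule.span ℂ (hermiteSchwartz '' {α | ((∑ j, α j : ℕ) : ℤ) = l})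

theorem hermiteSpan_eq_map (l : ℤ) :
    hermiteSpan n l = (hermiteSchwartzSpan n l).map (schwartzToL2 n) := by
  rw [hermiteSpan, hermiteSchwartzSpan, Submodule.map_span, Set.image_image]
  congr 1
  ext f
  have key : ∀ α : Fin n → ℕ, schwartzToL2 n (hermiteSchwartz α) =ᵐ[volume] hermiteFnMulti α :=
    fun α => (coeFn_schwartzToL2 _).trans (Filter.Eventually.of_forall (hermiteSchwartz_apply α))
  constructor
  · rintro ⟨α, hα, hf⟩
    exact ⟨α, hα, Lp.ext ((key α).trans hf.symm)⟩
  · rintro ⟨α, hα, rfl⟩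
    exact ⟨α, hα, key α⟩

/-! ### Clifford multiplication on Schwartz functions -/

/-- Clifford multiplication by the basis vectors on the Schwartz space. -/
def cliffSchwartz (n : ℕ) :
    Fin n ⊕ Fin n →
      (𝓢(EuclideanSpace ℝ (Fin n), ℂ) →ₗ[ℂ] 𝓢(EuclideanSpace ℝ (Fin n), ℂ))
  | Sum.inl j => (SchwartzMap.smulLeftCLM ℂ
      (fun x : EuclideanSpace ℝ (Fin n) => Complex.I * (x j : ℂ))).toLinearMap
  | Sum.inr j => (LineDeriv.lineDerivOpCLM ℂ 𝓢(EuclideanSpace ℝ (Fin n), ℂ)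
      (EuclideanSpace.single j (1 : ℝ) : EuclideanSpace ℝ (Fin n))).toLinearMap

theorem hasTemperateGrowth_I_mul_coord (j : Fin n) :
    Function.HasTemperateGrowth (fun x : EuclideanSpace ℝ (Fin n) => Complex.I * (x j : ℂ)) :=
  (Function.HasTemperateGrowth.const Complex.I).mul
    (Function.HasTemperateGrowth.comp Function.Complex.hasTemperateGrowth_ofReal
      (hasTemperateGrowth_coord j))

theorem cliffSchwartz_inl_apply (j : Fin n) (f : 𝓢(EuclideanSpace ℝ (Fin n), ℂ))
    (x : EuclideanSpace ℝ (Fin n)) :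
    cliffSchwartz n (Sum.inl j) f x = Complex.I * x j * f x :=
  SchwartzMap.smulLeftCLM_apply_apply (hasTemperateGrowth_I_mul_coord j) f x

theorem cliffSchwartz_inr_apply (j : Fin n) (f : 𝓢(EuclideanSpace ℝ (Fin n), ℂ))
    (x : EuclideanSpace ℝ (Fin n)) :
    cliffSchwartz n (Sum.inr j) f x = lineDeriv ℝ f x (EuclideanSpace.single j 1) :=
  SchwartzMap.lineDerivOp_apply _ f x

/-- Distributional multiplication and differentiation extend the classical ones. This is what puts
the image of `V ⊗ U` into the domain of `D`. -/
theorem cliffBasis_schwartzToL2 (a : Fin n ⊕ Fin n) (f : 𝓢(EuclideanSpace ℝ (Fin n), ℂ)) :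
    cliffBasis n a (schwartzToL2 n f) = toDistr n (schwartzToL2 n (cliffSchwartz n a f)) := by
  have key : ∀ f : 𝓢(EuclideanSpace ℝ (Fin n), ℂ), toDistr n (schwartzToL2 n f) =
      f.toTemperedDistributionCLM (EuclideanSpace ℝ (Fin n)) ℂ volume :=
    fun f => Lp.toTemperedDistribution_toLp_eq f
  rcases a with j | j
  · change TemperedDistribution.smulLeftCLM ℂ _ (toDistr n (schwartzToL2 n f)) = _
    rw [key, key]
    ext g
    have h := hasTemperateGrowth_I_mul_coord j
    rw [TemperedDistribution.smulLeftCLM_apply_apply,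
      SchwartzMap.toTemperedDistributionCLM_apply_apply volume,
      SchwartzMap.toTemperedDistributionCLM_apply_apply volume]
    refine integral_congr_ae (Filter.Eventually.of_forall fun x => ?_)
    simp only [cliffSchwartz_inl_apply, SchwartzMap.smulLeftCLM_apply_apply h, smul_eq_mul]
    ring
  · change LineDeriv.lineDerivOp (EuclideanSpace.single j (1 : ℝ) : EuclideanSpace ℝ (Fin n))
      (toDistr n (schwartzToL2 n f)) = _
    rw [key, key]
    exact TemperedDistribution.lineDerivOp_toTemperedDistributionCLM_eq f _

/-- Isolates the `j`-th factor, so that the one-variable recursions apply in that coordinate. -/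
theorem hermiteFnMulti_update (α : Fin n → ℕ) (j : Fin n) (k : ℕ)
    (x : EuclideanSpace ℝ (Fin n)) :
    hermiteFnMulti (Function.update α j k) x =
      hermiteFn k (x j) * ((∏ i ∈ Finset.univ.erase j, hermiteFn (α i) (x i) : ℝ) : ℂ) := by
  rw [hermiteFnMulti, ← Finset.mul_prod_erase _ _ (Finset.mem_univ j), Complex.ofReal_mul]
  congr 2
  · simp
  · exact Finset.prod_congr rfl fun i hi => by
      rw [Function.update_of_ne (Finset.ne_of_mem_erase hi)]

theorem cliffSchwartz_inl_hermite (α : Fin n → ℕ) (j : Fin n) :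
    cliffSchwartz n (Sum.inl j) (hermiteSchwartz α) =
      (-Complex.I / 2) • hermiteSchwartz (Function.update α j (α j + 1)) +
      (-Complex.I * α j) • hermiteSchwartz (Function.update α j (α j - 1)) := by
  ext x
  have h := congrArg Complex.ofReal (mul_hermiteFn (α j) (x j))
  push_cast at h
  have h2 : hermiteSchwartz α x = hermiteFn (α j) (x j) *
      ((∏ i ∈ Finset.univ.erase j, hermiteFn (α i) (x i) : ℝ) : ℂ) := by
    rw [hermiteSchwartz_apply, ← hermiteFnMulti_update, Function.update_eq_self]
  rw [cliffSchwartz_inl_apply, h2]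
  simp only [add_apply, smul_apply, hermiteSchwartz_apply,
    hermiteFnMulti_update, smul_eq_mul]
  linear_combination (Complex.I *
    ((∏ i ∈ Finset.univ.erase j, hermiteFn (α i) (x i) : ℝ) : ℂ)) * h

theorem cliffSchwartz_inr_hermite (α : Fin n → ℕ) (j : Fin n) :
    cliffSchwartz n (Sum.inr j) (hermiteSchwartz α) =
      (1 / 2 : ℂ) • hermiteSchwartz (Function.update α j (α j + 1)) +
      (-α j : ℂ) • hermiteSchwartz (Function.update α j (α j - 1)) := by
  ext x
  have h2 : ∀ t : ℝ, hermiteSchwartz α (x + t • EuclideanSpace.single j 1) =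
      hermiteFn (α j) (x j + t) *
      ((∏ i ∈ Finset.univ.erase j, hermiteFn (α i) (x i) : ℝ) : ℂ) := by
    intro t
    nth_rewrite 1 [← Function.update_eq_self j α]
    rw [hermiteSchwartz_apply, hermiteFnMulti_update]
    congr 2
    · simp
    · refine Finset.prod_congr rfl fun i hi => ?_
      simp [Finset.ne_of_mem_erase hi]
  have h3 : HasDerivAt (fun t : ℝ => hermiteFn (α j) (x j + t))
      ((hermiteFn (α j + 1) (x j) - 2 * α j * hermiteFn (α j - 1) (x j)) / 2) 0 := by
    have := hasDerivAt_hermiteFn (α j) (x j + 0)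
    have h4 := this.comp_const_add (x j) 0
    simpa using h4
  rw [cliffSchwartz_inr_apply, lineDeriv]
  simp only [h2]
  rw [(h3.ofReal_comp.mul_const _).deriv]
  simp only [add_apply, smul_apply, hermiteSchwartz_apply,
    hermiteFnMulti_update, smul_eq_mul]
  push_cast
  ring

theorem sum_update_succ (α : Fin n → ℕ) (j : Fin n) :
    ((∑ i, Function.update α j (α j + 1) i : ℕ) : ℤ) = ((∑ i, α i : ℕ) : ℤ) + 1 := by
  rw [Finset.sum_update_of_mem (Finset.mem_univ j), ← Finset.add_sum_erase _ _ (Finset.mem_univ j),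
    Finset.sdiff_singleton_eq_erase]
  push_cast
  ring

theorem sum_update_pred (α : Fin n → ℕ) (j : Fin n) (h : α j ≠ 0) :
    ((∑ i, Function.update α j (α j - 1) i : ℕ) : ℤ) = ((∑ i, α i : ℕ) : ℤ) - 1 := by
  rw [Finset.sum_update_of_mem (Finset.mem_univ j), ← Finset.add_sum_erase _ _ (Finset.mem_univ j),
    Finset.sdiff_singleton_eq_erase]
  push_cast [Nat.one_le_iff_ne_zero.mpr h]
  ring

theorem cliffSchwartz_mem (a : Fin n ⊕ Fin n) (l : ℤ) {f : 𝓢(EuclideanSpace ℝ (Fin n), ℂ)}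
    (hf : f ∈ hermiteSchwartzSpan n l) :
    cliffSchwartz n a f ∈ hermiteSchwartzSpan n (l - 1) ⊔ hermiteSchwartzSpan n (l + 1) := by
  suffices h : hermiteSchwartzSpan n l ≤
      (hermiteSchwartzSpan n (l - 1) ⊔ hermiteSchwartzSpan n (l + 1)).comap (cliffSchwartz n a) from
    h hf
  rw [hermiteSchwartzSpan, Submodule.span_le]
  rintro _ ⟨α, hα, rfl⟩
  have h1 : ∀ j, hermiteSchwartz (Function.update α j (α j + 1)) ∈
      hermiteSchwartzSpan n (l + 1) := fun j =>
    Submodule.subset_span ⟨_, (sum_update_succ α j).trans (by rw [hα]), rfl⟩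
  have h2 : ∀ (j) (c : ℂ), (c * α j) • hermiteSchwartz (Function.update α j (α j - 1)) ∈
      hermiteSchwartzSpan n (l - 1) := by
    intro j c
    by_cases h : α j = 0
    -- Here the truncated index would leave the degree at `l`, but its coefficient is zero.
    · simp [h]
    · exact Submodule.smul_mem _ _
        (Submodule.subset_span ⟨_, (sum_update_pred α j h).trans (by rw [hα]), rfl⟩)
  change cliffSchwartz n a (hermiteSchwartz α) ∈
    hermiteSchwartzSpan n (l - 1) ⊔ hermiteSchwartzSpan n (l + 1)
  rcases a with j | j
  · rw [cliffSchwartz_inl_hermite, add_comm (_ • _)]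
    exact Submodule.add_mem_sup (h2 j _) (Submodule.smul_mem _ _ (h1 j))
  · rw [cliffSchwartz_inr_hermite, add_comm (_ • _), neg_eq_neg_one_mul]
    exact Submodule.add_mem_sup (h2 j _) (Submodule.smul_mem _ _ (h1 j))

/-! ### The harmonic oscillator and its eigenvalues -/

/-- The harmonic oscillator `∑ⱼ (xⱼ² - ∂ⱼ²)` on the Schwartz space. -/
def oscillator (n : ℕ) :
    𝓢(EuclideanSpace ℝ (Fin n), ℂ) →ₗ[ℂ] 𝓢(EuclideanSpace ℝ (Fin n), ℂ) :=
  -∑ a, cliffSchwartz n a ∘ₗ cliffSchwartz n a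

theorem oscillator_apply (f : 𝓢(EuclideanSpace ℝ (Fin n), ℂ)) :
    oscillator n f = -∑ a, cliffSchwartz n a (cliffSchwartz n a f) := by
  simp [oscillator, -Fintype.sum_sum_type]

/-- In each coordinate the double raising and double lowering terms of `X_j²` and `X_{n+j}²` cancel;
the mixed terms add up to `-(2α_j + 1)`. -/
theorem oscillator_hermiteSchwartz (α : Fin n → ℕ) :
    oscillator n (hermiteSchwartz α) =
      ((2 * (∑ j, α j : ℕ) + n : ℕ) : ℂ) • hermiteSchwartz α := by
  have key : ∀ j, cliffSchwartz n (Sum.inl j) (cliffSchwartz n (Sum.inl j) (hermiteSchwartz α)) +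
      cliffSchwartz n (Sum.inr j) (cliffSchwartz n (Sum.inr j) (hermiteSchwartz α)) =
      (-(2 * α j + 1) : ℂ) • hermiteSchwartz α := by
    intro j
    simp only [cliffSchwartz_inl_hermite, cliffSchwartz_inr_hermite, map_add, map_smul,
      Function.update_self, Function.update_idem]
    by_cases h : α j = 0
    · simp only [h, Nat.zero_add, Nat.sub_self]
      have h0 : Function.update α j 0 = α := by rw [← h, Function.update_eq_self]
      simp only [h0]
      match_scalars <;> simp <;> ring_nf <;> simp [Complex.I_sq] <;> ring_nf
    · have h0 : α j + 1 - 1 = α j := rfl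
      have h1 : α j - 1 + 1 = α j := Nat.sub_add_cancel (Nat.one_le_iff_ne_zero.mpr h)
      simp only [h0, h1, Function.update_eq_self]
      match_scalars <;> ring_nf <;> simp [Complex.I_sq] <;> ring_nf
  rw [oscillator_apply, Fintype.sum_sum_type]
  rw [← Finset.sum_add_distrib, Finset.sum_congr rfl fun j _ => key j, ← Finset.sum_smul,
    ← neg_smul]
  congr 1
  simp [Finset.sum_add_distrib, Finset.mul_sum]

theorem oscillator_of_mem {l : ℤ} {f : 𝓢(EuclideanSpace ℝ (Fin n), ℂ)}
    (hf : f ∈ hermiteSchwartzSpan n l) : oscillator n f = (2 * l + n : ℂ) • f := by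
  suffices h : hermiteSchwartzSpan n l ≤
      Module.End.eigenspace (oscillator n) (2 * l + n : ℂ) from
    Module.End.mem_eigenspace_iff.mp (h hf)
  rw [hermiteSchwartzSpan, Submodule.span_le]
  rintro _ ⟨α, hα, rfl⟩
  refine Module.End.mem_eigenspace_iff.mpr ?_
  rw [oscillator_hermiteSchwartz, ← show ((∑ j, α j : ℕ) : ℤ) = l from hα]
  push_cast
  rfl

theorem hermiteSchwartzSpan_of_neg {l : ℤ} (hl : l < 0) : hermiteSchwartzSpan n l = ⊥ := by
  rw [hermiteSchwartzSpan, Submodule.span_eq_bot]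
  rintro _ ⟨α, hα, rfl⟩
  have h : ((∑ j, α j : ℕ) : ℤ) = l := hα
  omega

/-! ### The infinitesimal generators of the Weyl operators -/

/-- Dominated convergence applied to the squared norms, followed by the square root. -/
theorem tendsto_eLpNorm_two_of_dominated {α ι : Type*} [MeasurableSpace α] {μ : Measure α}
    {l : Filter ι} [l.IsCountablyGenerated] {F : ι → α → ℂ} (b : α → ℝ)
    (hF : ∀ᶠ i in l, AEStronglyMeasurable (F i) μ) (hb : MemLp b 2 μ)
    (hFb : ∀ᶠ i in l, ∀ x, ‖F i x‖ ≤ b x) (hlim : ∀ x, Filter.Tendsto (F · x) l (nhds 0)) :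
    Filter.Tendsto (fun i => eLpNorm (F i) 2 μ) l (nhds 0) := by
  have h2 : (2 : ℝ≥0∞) ≠ 0 := two_ne_zero
  simp only [eLpNorm_eq_lintegral_rpow_enorm_toReal h2 ENNReal.ofNat_ne_top, ENNReal.toReal_ofNat]
  have h1 : Filter.Tendsto (fun i => ∫⁻ x, ‖F i x‖ₑ ^ (2 : ℝ) ∂μ) l
      (nhds (∫⁻ _, (0 : ℝ≥0∞) ∂μ)) := by
    refine tendsto_lintegral_filter_of_dominated_convergence' (fun x => ‖b x‖ₑ ^ (2 : ℝ))
      ?_ ?_ ?_ ?_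
    · filter_upwards [hF] with i hi using hi.enorm.pow_const _
    · filter_upwards [hFb] with i hi
      refine Filter.Eventually.of_forall fun x => ?_
      gcongr
      exact enorm_le_iff_norm_le.mpr ((hi x).trans (le_abs_self _))
    · have := lintegral_rpow_enorm_lt_top_of_eLpNorm_lt_top h2 ENNReal.ofNat_ne_top hb.2
      simpa using this.ne
    · refine Filter.Eventually.of_forall fun x => ?_
      have := ((ENNReal.continuous_rpow_const (y := 2)).tendsto _).comp (hlim x).enorm
      simpa using! this
  have h3 := ((ENNReal.continuous_rpow_const (y := 1 / 2)).tendsto _).comp h1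
  simpa using! h3

/-- Clifford multiplication by the vector with coordinates `z` on the Schwartz space. -/
def cliffVec (z : Fin n ⊕ Fin n → ℝ) :
    𝓢(EuclideanSpace ℝ (Fin n), ℂ) →ₗ[ℂ] 𝓢(EuclideanSpace ℝ (Fin n), ℂ) :=
  ∑ a, (z a : ℂ) • cliffSchwartz n a

theorem cliffVec_apply (z : Fin n ⊕ Fin n → ℝ) (f : 𝓢(EuclideanSpace ℝ (Fin n), ℂ)) :
    cliffVec z f = ∑ a, (z a : ℂ) • cliffSchwartz n a f := by
  simp [cliffVec, -Fintype.sum_sum_type]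

theorem cliffVec_single (a : Fin n ⊕ Fin n) : cliffVec (Pi.single a 1) = cliffSchwartz n a := by
  rw [cliffVec, Finset.sum_eq_single a] <;> simp +contextual

theorem qPart_eq_sum (z : Fin n ⊕ Fin n → ℝ) :
    qPart z = ∑ j, z (Sum.inr j) • (EuclideanSpace.single j 1 : EuclideanSpace ℝ (Fin n)) := by
  ext i
  simp [qPart, Finset.sum_apply, Pi.single_apply]

theorem qPart_smul (t : ℝ) (z : Fin n ⊕ Fin n → ℝ) : qPart (t • z) = t • qPart z := by
  ext i
  simp [qPart]

theorem schwartzMap_sum_apply {ι : Type*} (s : Finset ι)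
    (f : ι → 𝓢(EuclideanSpace ℝ (Fin n), ℂ)) (x : EuclideanSpace ℝ (Fin n)) :
    (∑ i ∈ s, f i) x = ∑ i ∈ s, f i x := by
  simp

theorem cliffVec_apply_apply (z : Fin n ⊕ Fin n → ℝ) (f : 𝓢(EuclideanSpace ℝ (Fin n), ℂ))
    (x : EuclideanSpace ℝ (Fin n)) :
    cliffVec z f x = Complex.I * ((∑ j, z (Sum.inl j) * x j : ℝ) : ℂ) * f x +
      fderiv ℝ f x (qPart z) := by
  rw [cliffVec_apply, schwartzMap_sum_apply, Fintype.sum_sum_type, qPart_eq_sum, map_sum]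
  simp only [smul_apply, cliffSchwartz_inl_apply, cliffSchwartz_inr_apply,
    (f.differentiable x).lineDeriv_eq_fderiv, map_smul, smul_eq_mul, Complex.real_smul]
  congr 1
  push_cast
  rw [Finset.mul_sum, Finset.sum_mul]
  exact Finset.sum_congr rfl fun j _ => by ring

/-- The function `W(z) f`, pointwise. -/
def weylFn (z : Fin n ⊕ Fin n → ℝ) (f : 𝓢(EuclideanSpace ℝ (Fin n), ℂ))
    (x : EuclideanSpace ℝ (Fin n)) : ℂ :=
  weylPhase z x * f (x + qPart z)

theorem coeFn_weyl_schwartzToL2 (z : Fin n ⊕ Fin n → ℝ)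
    (f : 𝓢(EuclideanSpace ℝ (Fin n), ℂ)) :
    weyl z (schwartzToL2 n f) =ᵐ[volume] weylFn z f := by
  refine (MemLp.coeFn_toLp (memLp_weyl z (schwartzToL2 n f))).trans ?_
  have h := (measurePreserving_add_right volume (qPart z)).quasiMeasurePreserving.ae_eq_comp
    (coeFn_schwartzToL2 f)
  filter_upwards [h] with x hx
  rw [weylFn, ← show _ = f (x + qPart z) from hx]
  rfl

theorem norm_weylPhase (z : Fin n ⊕ Fin n → ℝ) (x : EuclideanSpace ℝ (Fin n)) :
    ‖weylPhase z x‖ = 1 := by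
  rw [weylPhase, Complex.norm_exp_ofReal_mul_I]

/-- The phase contributes `i(p·x + t p·q) = i p·(x + tq)` and the shift contributes `∂_q`: together
they are Clifford multiplication evaluated at the shifted point. The derivative is taken at every
`t` for use in the mean value inequality. -/
theorem hasDerivAt_weylFn (z : Fin n ⊕ Fin n → ℝ) (f : 𝓢(EuclideanSpace ℝ (Fin n), ℂ))
    (x : EuclideanSpace ℝ (Fin n)) (t : ℝ) :
    HasDerivAt (fun t : ℝ => weylFn (t • z) f x) (weylFn (t • z) (cliffVec z f) x) t := by
  set A : ℝ := ∑ j, z (Sum.inl j) * x j with hA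
  set B : ℝ := ∑ j, z (Sum.inl j) * z (Sum.inr j) with hB
  have hphase : ∀ t : ℝ, weylPhase (t • z) x =
      Complex.exp (((t * A + t ^ 2 * B / 2 : ℝ) : ℂ) * Complex.I) := by
    intro t
    rw [weylPhase, hA, hB]
    congr 4
    · rw [Finset.mul_sum]
      exact Finset.sum_congr rfl fun j _ => by simp; ring
    · rw [Finset.mul_sum]
      exact congrArg (· / 2) (Finset.sum_congr rfl fun j _ => by simp; ring)
  have h0 : HasDerivAt (fun t : ℝ => t * A + t ^ 2 * B / 2) (A + t * B) t := by
    have h1 := ((hasDerivAt_id t).mul_const A).add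
      (((hasDerivAt_pow 2 t).mul_const B).div_const 2)
    convert! h1 using 1
    simp
    ring
  have h1 : HasDerivAt (fun t : ℝ => weylPhase (t • z) x)
      (weylPhase (t • z) x * (((A + t * B : ℝ) : ℂ) * Complex.I)) t := by
    simp only [hphase]
    exact (h0.ofReal_comp.mul_const Complex.I).cexp
  have h2 : HasDerivAt (fun t : ℝ => x + t • qPart z) (qPart z) t := by
    simpa using ((hasDerivAt_id t).smul_const (qPart z)).const_add x
  have h3 : HasDerivAt (fun t : ℝ => f (x + t • qPart z))
      (fderiv ℝ f (x + t • qPart z) (qPart z)) t :=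
    (f.differentiable (x + t • qPart z)).hasFDerivAt.comp_hasDerivAt t h2
  have h4 := h1.mul h3
  simp only [weylFn, qPart_smul]
  convert! h4 using 1
  have h5 : (∑ j, z (Sum.inl j) * (x + t • qPart z) j) = A + t * B := by
    rw [hA, hB, Finset.mul_sum, ← Finset.sum_add_distrib]
    exact Finset.sum_congr rfl fun j _ => by simp [qPart]; ring
  rw [cliffVec_apply_apply, h5]
  ring

/-- Schwartz decay of sufficiently high order `k`, made uniform in the shift by `1 + ‖x‖ ≤ (1 + ‖x +
sq‖)(1 + ‖q‖)`. -/
theorem exists_memLp_bound (f : 𝓢(EuclideanSpace ℝ (Fin n), ℂ))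
    (q : EuclideanSpace ℝ (Fin n)) :
    ∃ b : EuclideanSpace ℝ (Fin n) → ℝ, MemLp b 2 volume ∧
      ∀ x, ∀ s ∈ Set.Icc (-1 : ℝ) 1, ‖f (x + s • q)‖ ≤ b x := by
  obtain ⟨k, hk⟩ := Measure.HasTemperateGrowth.exists_eLpNorm_lt_top 2
    (μ := (volume : Measure (EuclideanSpace ℝ (Fin n)))) inferInstance
  set C : ℝ := 2 ^ k * ((Finset.Iic (k, 0)).sup fun m => SchwartzMap.seminorm ℝ m.1 m.2) f
  have hC : ∀ x, (1 + ‖x‖) ^ k * ‖f x‖ ≤ C := by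
    intro x
    have := SchwartzMap.one_add_le_sup_seminorm_apply (𝕜 := ℝ) (m := (k, 0)) le_rfl le_rfl f x
    simpa using this
  refine ⟨fun x => C * (1 + ‖q‖) ^ k * (1 + ‖x‖) ^ (-k : ℝ), MemLp.const_mul ⟨?_, hk⟩ _, ?_⟩
  · refine Continuous.aestronglyMeasurable ?_
    refine Continuous.rpow_const (by fun_prop) fun x => Or.inl ?_
    positivity
  · intro x s hs
    have hs' : |s| ≤ 1 := abs_le.mpr hs
    have hpos : 0 < (1 + ‖x‖) ^ k := by positivity
    change ‖f (x + s • q)‖ ≤ C * (1 + ‖q‖) ^ k * (1 + ‖x‖) ^ (-k : ℝ)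
    rw [Real.rpow_neg (by positivity), Real.rpow_natCast, ← div_eq_mul_inv, le_div_iff₀ hpos]
    have h1 : ‖x‖ ≤ ‖x + s • q‖ + ‖q‖ := by
      have h2 : ‖s • q‖ ≤ ‖q‖ := by
        rw [norm_smul]
        exact mul_le_of_le_one_left (norm_nonneg _) hs'
      calc ‖x‖ = ‖(x + s • q) - s • q‖ := by rw [add_sub_cancel_right]
        _ ≤ ‖x + s • q‖ + ‖s • q‖ := norm_sub_le _ _
        _ ≤ _ := by gcongr
    have h3 : (1 + ‖x‖) ≤ (1 + ‖x + s • q‖) * (1 + ‖q‖) := by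
      nlinarith [norm_nonneg q, norm_nonneg (x + s • q),
        mul_nonneg (norm_nonneg (x + s • q)) (norm_nonneg q)]
    calc ‖f (x + s • q)‖ * (1 + ‖x‖) ^ k
        ≤ ‖f (x + s • q)‖ * ((1 + ‖x + s • q‖) * (1 + ‖q‖)) ^ k := by gcongr
      _ = (1 + ‖x + s • q‖) ^ k * ‖f (x + s • q)‖ * (1 + ‖q‖) ^ k := by rw [mul_pow]; ring
      _ ≤ C * (1 + ‖q‖) ^ k := by
        gcongr
        exact hC _

theorem continuous_weylFn (z : Fin n ⊕ Fin n → ℝ) (f : 𝓢(EuclideanSpace ℝ (Fin n), ℂ)) :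
    Continuous (weylFn z f) := by
  unfold weylFn weylPhase
  have := f.continuous
  fun_prop

theorem weylFn_zero (f : 𝓢(EuclideanSpace ℝ (Fin n), ℂ)) : weylFn 0 f = f := by
  ext x
  have h : qPart (0 : Fin n ⊕ Fin n → ℝ) = 0 := by ext i; simp [qPart]
  simp [weylFn, weylPhase, h]

theorem norm_weylFn_sub_le (z : Fin n ⊕ Fin n → ℝ) (f : 𝓢(EuclideanSpace ℝ (Fin n), ℂ))
    (x : EuclideanSpace ℝ (Fin n)) {C : ℝ}
    (hC : ∀ t ∈ Set.Icc (-1 : ℝ) 1, ‖weylFn (t • z) (cliffVec z f) x‖ ≤ C)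
    {t : ℝ} (ht : t ∈ Set.Icc (-1 : ℝ) 1) :
    ‖weylFn (t • z) f x - weylFn ((0 : ℝ) • z) f x‖ ≤ C * ‖t‖ := by
  have h := Convex.norm_image_sub_le_of_norm_hasDerivWithin_le
    (f := fun t : ℝ => weylFn (t • z) f x) (f' := fun t : ℝ => weylFn (t • z) (cliffVec z f) x)
    (s := Set.Icc (-1 : ℝ) 1) (x := 0) (y := t)
    (fun s _ => (hasDerivAt_weylFn z f x s).hasDerivWithinAt) hC
    (convex_Icc (-1 : ℝ) 1) ⟨by norm_num, by norm_num⟩ ht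
  rwa [sub_zero] at h

/-- On Schwartz functions the one-parameter group `t ↦ W(t z)` is generated by the Clifford
multiplication with the vector of coordinates `z`. -/
theorem hasDerivAt_weyl (z : Fin n ⊕ Fin n → ℝ) (f : 𝓢(EuclideanSpace ℝ (Fin n), ℂ)) :
    HasDerivAt (fun t : ℝ => weyl (t • z) (schwartzToL2 n f))
      (schwartzToL2 n (cliffVec z f)) 0 := by
  obtain ⟨b, hb, hfb⟩ := exists_memLp_bound (cliffVec z f) (qPart z)
  have hbound : ∀ x, ∀ t ∈ Set.Icc (-1 : ℝ) 1, ‖weylFn (t • z) (cliffVec z f) x‖ ≤ b x := by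
    intro x t ht
    rw [weylFn, norm_mul, norm_weylPhase, one_mul, qPart_smul]
    exact hfb x t ht
  rw [hasDerivAt_iff_tendsto_slope_zero]
  refine (Lp.tendsto_Lp_iff_tendsto_eLpNorm _ (cliffVec z f)
    ((cliffVec z f).memLp 2 volume)).mpr ?_
  set F : ℝ → EuclideanSpace ℝ (Fin n) → ℂ := fun t x =>
    t⁻¹ • (weylFn ((0 + t) • z) f x - weylFn ((0 : ℝ) • z) f x) - cliffVec z f x
  have hF : ∀ t, eLpNorm (⇑(t⁻¹ • (weyl ((0 + t) • z) (schwartzToL2 n f) -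
      weyl ((0 : ℝ) • z) (schwartzToL2 n f))) - ⇑(cliffVec z f)) 2 volume =
      eLpNorm (F t) 2 volume := by
    intro t
    refine eLpNorm_congr_ae ?_
    filter_upwards [Lp.coeFn_smul t⁻¹ (weyl ((0 + t) • z) (schwartzToL2 n f) -
      weyl ((0 : ℝ) • z) (schwartzToL2 n f)), Lp.coeFn_sub (weyl ((0 + t) • z) (schwartzToL2 n f))
      (weyl ((0 : ℝ) • z) (schwartzToL2 n f)), coeFn_weyl_schwartzToL2 ((0 + t) • z) f,
      coeFn_weyl_schwartzToL2 ((0 : ℝ) • z) f] with x h1 h2 h3 h4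
    rw [Pi.sub_apply, h1, Pi.smul_apply, h2, Pi.sub_apply, h3, h4]
  simp only [hF]
  -- One `b` bounds the difference quotient, by the mean value inequality; the other bounds its
  -- pointwise limit.
  refine tendsto_eLpNorm_two_of_dominated (fun x => b x + b x)
    (Filter.Eventually.of_forall fun t => ?_) (hb.add hb) ?_ fun x => ?_
  · have h1 := continuous_weylFn ((0 + t) • z) f
    have h2 := continuous_weylFn ((0 : ℝ) • z) f
    have h3 := (cliffVec z f).continuous
    exact (((h1.sub h2).const_smul t⁻¹).sub h3).aestronglyMeasurable
  · have hnhds : Set.Icc (-1 : ℝ) 1 ∈ nhdsWithin (0 : ℝ) {0}ᶜ :=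
      mem_nhdsWithin_of_mem_nhds (Icc_mem_nhds (by norm_num) (by norm_num))
    filter_upwards [hnhds, self_mem_nhdsWithin] with t ht ht0 x
    have ht0' : t ≠ 0 := ht0
    have h0 : (0 : ℝ) ∈ Set.Icc (-1 : ℝ) 1 := by constructor <;> norm_num
    have h1 := norm_weylFn_sub_le z f x (hbound x) ht
    have h2 : ‖cliffVec z f x‖ ≤ b x := by
      have := hbound x 0 h0
      rwa [zero_smul, weylFn_zero] at this
    refine (norm_sub_le _ _).trans (add_le_add ?_ h2)
    rw [norm_smul, norm_inv, zero_add, inv_mul_le_iff₀ (norm_pos_iff.mpr ht0')]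
    rwa [mul_comm] at h1
  · have h1 := (hasDerivAt_iff_tendsto_slope_zero.mp (hasDerivAt_weylFn z f x 0))
    rw [zero_smul, weylFn_zero, weylFn_zero] at h1
    have h2 := h1.sub_const (cliffVec z f x)
    rw [sub_self] at h2
    simpa only [F, zero_smul, weylFn_zero] using! h2

/-! ### Equivariance of Clifford multiplication under the metaplectic group -/

theorem Mp_le_Mpc (n : ℕ) : Mp n ≤ Mpc n :=
  Subgroup.commutator_le.mpr fun _ h₁ _ h₂ =>
    (Mpc n).mul_mem ((Mpc n).mul_mem ((Mpc n).mul_mem h₁ h₂) ((Mpc n).inv_mem h₁))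
      ((Mpc n).inv_mem h₂)

/-- Clifford multiplication is equivariant under `Mpᶜ(n)`. -/
theorem Mpc_cliffVec {a : Sp n × U2 n} (ha : a ∈ Mpc n)
    {f g : 𝓢(EuclideanSpace ℝ (Fin n), ℂ)}
    (hfg : a.2 (schwartzToL2 n f) = schwartzToL2 n g) (z : Fin n ⊕ Fin n → ℝ) :
    a.2 (schwartzToL2 n (cliffVec z f)) = schwartzToL2 n (cliffVec (a.1.1 *ᵥ z) g) := by
  have h1 : HasDerivAt (fun t : ℝ => a.2 (weyl (t • z) (schwartzToL2 n f)))
      (a.2 (schwartzToL2 n (cliffVec z f))) 0 :=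
    ((a.2.toContinuousLinearEquiv : L2 n →L[ℂ] L2 n).restrictScalars ℝ).hasFDerivAt.comp_hasDerivAt
      0 (hasDerivAt_weyl z f)
  have h2 := hasDerivAt_weyl (a.1.1 *ᵥ z) g
  -- The two curves agree by the defining relation of `Mpᶜ(n)`, so their derivatives at `0` agree.
  -- The right-hand curve is differentiable because `hfg` makes the image of `f` a Schwartz
  -- function.
  have h3 : (fun t : ℝ => a.2 (weyl (t • z) (schwartzToL2 n f))) =
      fun t : ℝ => weyl (t • (a.1.1 *ᵥ z)) (schwartzToL2 n g) := by
    ext1 t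
    rw [ha (t • z) (schwartzToL2 n f), hfg, Matrix.mulVec_smul]
  rw [h3] at h1
  exact h1.unique h2

theorem cliffVec_mulVec_single (A : Matrix (Fin n ⊕ Fin n) (Fin n ⊕ Fin n) ℝ)
    (a : Fin n ⊕ Fin n) :
    cliffVec (A *ᵥ Pi.single a 1) = ∑ b, (A b a : ℂ) • cliffSchwartz n b := by
  simp [cliffVec, -Fintype.sum_sum_type]

theorem Mpc_cliffSchwartz {a : Sp n × U2 n} (ha : a ∈ Mpc n)
    {f g : 𝓢(EuclideanSpace ℝ (Fin n), ℂ)}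
    (hfg : a.2 (schwartzToL2 n f) = schwartzToL2 n g) (c : Fin n ⊕ Fin n) :
    a.2 (schwartzToL2 n (cliffSchwartz n c f)) =
      schwartzToL2 n (∑ b, (a.1.1 b c : ℂ) • cliffSchwartz n b g) := by
  have h := Mpc_cliffVec ha hfg (Pi.single c 1)
  rw [cliffVec_single, cliffVec_mulVec_single] at h
  simpa [-Fintype.sum_sum_type] using h

/-- The elements of `Mpᶜ(n)` over unitary matrices commute with the harmonic oscillator. -/
theorem Mpc_oscillator {a : Sp n × U2 n} (ha : a ∈ Mpc n) (hA : a.1.1 * a.1.1ᵀ = 1)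
    {f g : 𝓢(EuclideanSpace ℝ (Fin n), ℂ)}
    (hfg : a.2 (schwartzToL2 n f) = schwartzToL2 n g) :
    a.2 (schwartzToL2 n (oscillator n f)) = schwartzToL2 n (oscillator n g) := by
  simp only [oscillator_apply, map_neg, map_sum (schwartzToL2 n), map_sum a.2]
  congr 1
  have h1 : ∀ c, a.2 (schwartzToL2 n (cliffSchwartz n c (cliffSchwartz n c f))) =
      ∑ b, ∑ d, ((a.1.1 b c * a.1.1 d c : ℝ) : ℂ) •
        schwartzToL2 n (cliffSchwartz n b (cliffSchwartz n d g)) := by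
    intro c
    rw [Mpc_cliffSchwartz ha (Mpc_cliffSchwartz ha hfg c) c]
    simp only [map_sum, map_smul, Finset.smul_sum, smul_smul, Complex.ofReal_mul]
  rw [Finset.sum_congr rfl fun c _ => h1 c, Finset.sum_comm]
  refine Finset.sum_congr rfl fun b _ => ?_
  rw [Finset.sum_comm]
  -- Orthogonality of the matrix collapses the double sum to its diagonal.
  have h2 : ∀ d, ∑ c, a.1.1 b c * a.1.1 d c = if b = d then 1 else 0 := by
    intro d
    have := congrFun (congrFun hA b) d
    rwa [Matrix.mul_apply, Matrix.one_apply] at this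
  simp only [← Finset.sum_smul, ← Complex.ofReal_sum, h2]
  rw [Finset.sum_eq_single b]
  · rw [if_pos rfl, Complex.ofReal_one]
    exact one_smul ℂ _
  · intro d _ hd
    rw [if_neg hd.symm, Complex.ofReal_zero]
    exact zero_smul ℂ _
  · exact fun h => absurd (Finset.mem_univ b) h

/-! ### Burnside's theorem -/

/-- **Burnside's theorem**: the operators of an irreducible finite-dimensional representation over
an algebraically closed field span all endomorphisms. -/
theorem span_range_eq_top_of_isIrreducible {k G V : Type*} [Field k] [IsAlgClosed k] [Monoid G]
    [AddCommGroup V] [Module k V] [FiniteDimensional k V] (τ : Representation k G V)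
    (hirr : τ.IsIrreducible) : Submodule.span k (Set.range τ) = ⊤ := by
  have : IsSimpleModule (MonoidAlgebra k G) τ.asModule :=
    (Representation.irreducible_iff_isSimpleModule_asModule τ).mp hirr
  have hs := IsSimpleModule.algebraMap_end_bijective_of_isAlgClosed k
    (A := MonoidAlgebra k G) (V := τ.asModule)
  have hrange : ∀ r : MonoidAlgebra k G,
      τ.asAlgebraHom r ∈ Submodule.span k (Set.range τ) := by
    intro r
    induction r using MonoidAlgebra.induction_on with
    | of g => exact Submodule.subset_span ⟨g, by simp⟩
    | add a b ha hb => rw [map_add]; exact Submodule.add_mem _ ha hb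
    | smul c a ha => rw [map_smul]; exact Submodule.smul_mem _ _ ha
  rw [eq_top_iff]
  intro T _
  -- By Schur's lemma the commutant consists of scalars, so every `k`-linear `T` is linear over it.
  -- Jacobson density then yields an element of the group algebra that agrees with `T` on a basis.
  let T' : Module.End (Module.End (MonoidAlgebra k G) τ.asModule) τ.asModule :=
    { toFun := fun v => τ.asModuleEquiv.symm (T (τ.asModuleEquiv v))
      map_add' := fun v w => by simp
      map_smul' := fun φ v => by
        obtain ⟨c, rfl⟩ := hs.2 φ
        simp }
  let b := Module.finBasis k V
  classical
  obtain ⟨r, hr⟩ := jacobson_density T' (Finset.univ.image fun i => τ.asModuleEquiv.symm (b i))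
  have hT : T = τ.asAlgebraHom r := by
    refine b.ext fun i => ?_
    have h := hr (τ.asModuleEquiv.symm (b i)) (Finset.mem_image_of_mem _ (Finset.mem_univ i))
    have h2 := congrArg τ.asModuleEquiv h
    rw [Representation.asModuleEquiv_map_smul] at h2
    simpa [T'] using h2
  rw [hT]
  exact hrange r

/-- A tensor `t` in `V ⊗ U`, `U ⊆ Hom(V, W)`, vanishes if the contraction of `τ(g) ⊗ 1` applied to
`t` vanishes for all `g`. -/
theorem tensor_eq_zero_of_isIrreducible {k G V W : Type*} [Field k] [IsAlgClosed k] [Monoid G]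
    [AddCommGroup V] [Module k V] [FiniteDimensional k V] [AddCommGroup W] [Module k W]
    (τ : Representation k G V) (hirr : τ.IsIrreducible) (U : Submodule k (V →ₗ[k] W))
    (t : V ⊗[k] U)
    (ht : ∀ g, TensorProduct.lift (LinearMap.mk₂ k (fun v (L : U) => L.1 (τ g v))
      (by simp) (by simp) (by simp) (by simp)) t = 0) : t = 0 := by
  let b := Module.finBasis k V
  obtain ⟨c, rfl⟩ : ∃ c : Fin (Module.finrank k V) → U, t = ∑ i, b i ⊗ₜ[k] c i := by
    clear ht
    induction t using TensorProduct.induction_on with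
    | zero => exact ⟨0, by simp⟩
    | tmul v L =>
      refine ⟨fun i => b.repr v i • L, ?_⟩
      nth_rewrite 1 [← b.sum_repr v]
      rw [TensorProduct.sum_tmul]
      exact Finset.sum_congr rfl fun i _ => TensorProduct.smul_tmul _ _ _
    | add x y hx hy =>
      obtain ⟨c, rfl⟩ := hx
      obtain ⟨d, rfl⟩ := hy
      exact ⟨c + d, by simp [TensorProduct.tmul_add, Finset.sum_add_distrib]⟩
  -- The relation is linear in `T` and holds for each `τ(g)`; Burnside's theorem extends it to all
  -- `T`.
  have h1 : ∀ T : V →ₗ[k] V, ∑ i, (c i).1 (T (b i)) = 0 := by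
    intro T
    have hT : T ∈ Submodule.span k (Set.range τ) := by
      rw [span_range_eq_top_of_isIrreducible τ hirr]; trivial
    induction hT using Submodule.span_induction with
    | mem T hT =>
      obtain ⟨g, rfl⟩ := hT
      simpa using ht g
    | zero => simp
    | add S T _ _ hS hT => simp [Finset.sum_add_distrib, hS, hT]
    | smul a T _ hT => simp [← Finset.smul_sum, hT]
  have h2 : ∀ i, c i = 0 := by
    intro i
    ext v
    -- The rank-one map that sends `b i` to `v` and kills the other basis vectors isolates `c i`.
    have := h1 ((b.coord i).smulRight v)
    rw [Finset.sum_eq_single i] at this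
    · simpa using this
    · intro j _ hj
      simp [hj]
    · simp
  simp [h2]

/-! ### Differentials of representations -/

/-- The chain rule for a continuous real-linear map after a function on a manifold. -/
theorem mfderiv_clm_comp {E G W W' : Type*} [NormedAddCommGroup E] [NormedSpace ℝ E]
    [TopologicalSpace G] [ChartedSpace E G] [NormedAddCommGroup W] [NormedSpace ℝ W]
    [NormedAddCommGroup W'] [NormedSpace ℝ W'] (L : W →L[ℝ] W') {f : G → W} {x : G}
    (hf : MDifferentiableAt 𝓘(ℝ, E) 𝓘(ℝ, W) f x) (X : E) :
    (mfderiv 𝓘(ℝ, E) 𝓘(ℝ, W') (fun g => L (f g)) x : E →L[ℝ] W') X =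
      L ((mfderiv 𝓘(ℝ, E) 𝓘(ℝ, W) f x : E →L[ℝ] W) X) := by
  have h := mfderiv_comp x (I' := 𝓘(ℝ, W)) (g := L) L.mdifferentiableAt hf
  have h2 : (L ∘ f) = fun g => L (f g) := rfl
  rw [h2, L.mfderiv_eq] at h
  rw [h]
  rfl

section Lie

variable {E : Type*} [NormedAddCommGroup E] [NormedSpace ℝ E]
  {G : Type*} [TopologicalSpace G] [ChartedSpace E G] [Group G]
  {V : Type*} [NormedAddCommGroup V] [NormedSpace ℂ V]
  (τ : Representation ℂ G V)

theorem dRep_smul_left (c : ℝ) (X : GroupLieAlgebra 𝓘(ℝ, E) G) (v : V) :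
    dRep E τ (c • X) v = c • dRep E τ X v :=
  map_smul (mfderiv 𝓘(ℝ, E) 𝓘(ℝ, V) (fun g : G => τ g v) 1) c X

theorem dRep_sum_left {ι : Type*} (s : Finset ι) (X : ι → GroupLieAlgebra 𝓘(ℝ, E) G) (v : V) :
    dRep E τ (∑ i ∈ s, X i) v = ∑ i ∈ s, dRep E τ (X i) v :=
  map_sum (mfderiv 𝓘(ℝ, E) 𝓘(ℝ, V) (fun g : G => τ g v) 1) X s

theorem mdifferentiable_rep (hτ : ∀ v, ContMDiff 𝓘(ℝ, E) 𝓘(ℝ, V) ∞ fun g : G => τ g v) (v : V) :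
    MDifferentiable 𝓘(ℝ, E) 𝓘(ℝ, V) fun g : G => τ g v :=
  (hτ v).mdifferentiable (by simp)

theorem dRep_add_right (hτ : ∀ v, ContMDiff 𝓘(ℝ, E) 𝓘(ℝ, V) ∞ fun g : G => τ g v)
    (X : GroupLieAlgebra 𝓘(ℝ, E) G) (v w : V) :
    dRep E τ X (v + w) = dRep E τ X v + dRep E τ X w := by
  have h := mfderiv_add (mdifferentiable_rep τ hτ v 1) (mdifferentiable_rep τ hτ w 1)
  have h2 : ((fun g : G => τ g v) + fun g : G => τ g w) = fun g : G => τ g (v + w) := by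
    ext g; simp
  rw [h2] at h
  unfold dRep
  rw [h]
  rfl

theorem dRep_smul_right (hτ : ∀ v, ContMDiff 𝓘(ℝ, E) 𝓘(ℝ, V) ∞ fun g : G => τ g v)
    (X : GroupLieAlgebra 𝓘(ℝ, E) G) (c : ℂ) (v : V) :
    dRep E τ X (c • v) = c • dRep E τ X v := by
  have h := mfderiv_clm_comp ((c • ContinuousLinearMap.id ℂ V).restrictScalars ℝ)
    (mdifferentiable_rep τ hτ v 1) X
  have h2 : (fun g : G => τ g (c • v)) =
      fun g => ((c • ContinuousLinearMap.id ℂ V).restrictScalars ℝ) (τ g v) := by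
    ext g
    simp
  unfold dRep
  rw [h2]
  exact h

/-- The differential of `τ` as a family of linear maps of `V`. -/
def dRepHom (hτ : ∀ v, ContMDiff 𝓘(ℝ, E) 𝓘(ℝ, V) ∞ fun g : G => τ g v)
    (X : GroupLieAlgebra 𝓘(ℝ, E) G) : V →ₗ[ℂ] V where
  toFun := dRep E τ X
  map_add' := dRep_add_right τ hτ X
  map_smul' := dRep_smul_right τ hτ X

variable [LieGroup 𝓘(ℝ, E) ∞ G]

/-- Differentiate `τ(h) τ(x) v = τ(h x h⁻¹) τ(h) v` at `x = 1`. -/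
theorem rep_dRep [FiniteDimensional ℂ V]
    (hτ : ∀ v, ContMDiff 𝓘(ℝ, E) 𝓘(ℝ, V) ∞ fun g : G => τ g v) (h : G)
    (X : GroupLieAlgebra 𝓘(ℝ, E) G) (v : V) :
    τ h (dRep E τ X v) = dRep E τ (Ad E h X) (τ h v) := by
  have hconj : MDifferentiableAt 𝓘(ℝ, E) 𝓘(ℝ, E) (fun x : G => h * x * h⁻¹) 1 := by
    have h1 : ContMDiff 𝓘(ℝ, E) 𝓘(ℝ, E) ∞ (fun x : G => h * x * h⁻¹) :=
      (contMDiff_mul_right (a := h⁻¹)).comp (contMDiff_mul_left (a := h))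
    exact h1.mdifferentiable (by simp) 1
  have h1 := mfderiv_clm_comp ((LinearMap.toContinuousLinearMap (τ h)).restrictScalars ℝ)
    (mdifferentiable_rep τ hτ v 1) X
  have h2 := mfderiv_comp_apply_of_eq (x := (1 : G)) (y := 1)
    (g := fun g : G => τ g (τ h v)) (f := fun x : G => h * x * h⁻¹)
    (mdifferentiable_rep τ hτ (τ h v) 1) hconj (by simp) X
  have h3 : (fun g : G => τ g (τ h v)) ∘ (fun x : G => h * x * h⁻¹) =
      fun g => τ h (τ g v) := by
    ext g
    simp only [Function.comp_apply, ← Module.End.mul_apply, ← map_mul]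
    simp
  rw [h3] at h2
  exact h1.symm.trans h2

/-- The derivative of `g ↦ τ(g⁻¹) v` along a left-invariant vector field. -/
theorem mfderiv_rep_inv (hτ : ∀ v, ContMDiff 𝓘(ℝ, E) 𝓘(ℝ, V) ∞ fun g : G => τ g v)
    (g : G) (Y : GroupLieAlgebra 𝓘(ℝ, E) G) (v : V) :
    (mfderiv 𝓘(ℝ, E) 𝓘(ℝ, V) (fun g : G => τ g⁻¹ v) g (mulInvariantVectorField Y g) : V) =
      -dRep E τ Y (τ g⁻¹ v) := by
  set w := τ g⁻¹ v with hw
  have hinv : ContMDiff 𝓘(ℝ, E) 𝓘(ℝ, E) ∞ (fun x : G => x⁻¹) := contMDiff_inv 𝓘(ℝ, E) ∞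
  have hinvd : MDifferentiableAt 𝓘(ℝ, E) 𝓘(ℝ, E) (fun x : G => x⁻¹) 1 :=
    hinv.mdifferentiable (by simp) 1
  have hmul : MDifferentiableAt 𝓘(ℝ, E) 𝓘(ℝ, E) (fun x : G => g * x) 1 :=
    (contMDiff_mul_left (I := 𝓘(ℝ, E)) (n := ∞) (a := g)).mdifferentiable (by simp) 1
  have hF : MDifferentiable 𝓘(ℝ, E) 𝓘(ℝ, V) (fun x : G => τ x⁻¹ v) :=
    ((hτ v).comp hinv).mdifferentiable (by simp)
  set Z : GroupLieAlgebra 𝓘(ℝ, E) G :=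
    (mfderiv 𝓘(ℝ, E) 𝓘(ℝ, E) (fun x : G => x⁻¹) 1 Y : E) with hZ
  -- Left translation moves the derivative to the unit element, as `τ((gx)⁻¹)v = τ(x⁻¹)w`.
  have h1 : (mfderiv 𝓘(ℝ, E) 𝓘(ℝ, V) (fun g : G => τ g⁻¹ v) g
      (mulInvariantVectorField Y g) : V) = dRep E τ Z w := by
    have e1 := mfderiv_comp_apply_of_eq (x := (1 : G)) (y := g)
      (g := fun x : G => τ x⁻¹ v) (f := fun x : G => g * x) (hF g) hmul (by simp) Y
    have e2 := mfderiv_comp_apply_of_eq (x := (1 : G)) (y := 1)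
      (g := fun x : G => τ x w) (f := fun x : G => x⁻¹) (mdifferentiable_rep τ hτ w 1) hinvd
      (by simp) Y
    have e3 : (fun x : G => τ x⁻¹ v) ∘ (fun x : G => g * x) =
        (fun x : G => τ x w) ∘ (fun x : G => x⁻¹) := by
      ext x
      simp only [Function.comp_apply, mul_inv_rev, map_mul, Module.End.mul_apply, hw]
    rw [e3] at e1
    exact e1.symm.trans e2
  -- The product rule for the constant function `x ↦ τ(x x⁻¹)w`; the differential `Z` of inversion
  -- need not be computed.
  have h2 : dRep E τ Y w + dRep E τ Z w = 0 := by
    have hP : ContMDiff (𝓘(ℝ, E).prod 𝓘(ℝ, E)) 𝓘(ℝ, V) ∞ (fun p : G × G => τ (p.1 * p.2) w) :=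
      (hτ w).comp (contMDiff_mul 𝓘(ℝ, E) ∞)
    have hD : MDifferentiableAt 𝓘(ℝ, E) (𝓘(ℝ, E).prod 𝓘(ℝ, E)) (fun x : G => (x, x⁻¹)) 1 :=
      mdifferentiableAt_id.prodMk hinvd
    have e1 := mfderiv_comp_apply_of_eq (x := (1 : G)) (y := ((1 : G), (1 : G)))
      (g := fun p : G × G => τ (p.1 * p.2) w) (f := fun x : G => (x, x⁻¹))
      (hP.mdifferentiable (by simp) _) hD (by simp) Y
    have e2 : (fun p : G × G => τ (p.1 * p.2) w) ∘ (fun x : G => (x, x⁻¹)) = fun _ => w := by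
      ext x; simp
    have e3 := mfderiv_prod_eq_add_apply (I := 𝓘(ℝ, E)) (I' := 𝓘(ℝ, E)) (I'' := 𝓘(ℝ, V))
      (f := fun p : G × G => τ (p.1 * p.2) w) (p := ((1 : G), (1 : G))) (v := (Y, Z))
      (hP.mdifferentiable (by simp) _)
    have e4 : mfderiv 𝓘(ℝ, E) (𝓘(ℝ, E).prod 𝓘(ℝ, E)) (fun x : G => (x, x⁻¹)) 1 Y = (Y, Z) := by
      have := MDifferentiableAt.mfderiv_prod (x := (1 : G)) (f := fun x : G => x)
        (g := fun x : G => x⁻¹) mdifferentiableAt_id hinvd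
      rw [this]
      have h5 : mfderiv 𝓘(ℝ, E) 𝓘(ℝ, E) (fun x : G => x) 1 = ContinuousLinearMap.id ℝ _ :=
        mfderiv_id
      rw [h5]
      rfl
    rw [e2, mfderiv_const] at e1
    rw [e4] at e1
    have e5 := e1.trans e3
    -- The tangent space at the value depends on the function, so equal functions are exchanged only
    -- after both derivatives are read as maps `E → V`.
    have key : ∀ (f f' : G → V) (_ : f = f') (X : E),
        (mfderiv 𝓘(ℝ, E) 𝓘(ℝ, V) f 1 : E →L[ℝ] V) X =
          (mfderiv 𝓘(ℝ, E) 𝓘(ℝ, V) f' 1 : E →L[ℝ] V) X := by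
      rintro f _ rfl X
      rfl
    have e6 : dRep E τ Y w =
        (mfderiv 𝓘(ℝ, E) 𝓘(ℝ, V) (fun z : G => τ (z * 1) w) 1 : E →L[ℝ] V) Y :=
      key _ _ (by ext z; rw [mul_one]) Y
    have e7 : dRep E τ Z w =
        (mfderiv 𝓘(ℝ, E) 𝓘(ℝ, V) (fun z : G => τ (1 * z) w) 1 : E →L[ℝ] V) Z :=
      key _ _ (by ext z; rw [one_mul]) Z
    rw [e6, e7]
    exact e5.symm
  exact h1.trans (eq_neg_of_add_eq_zero_right h2)

end Lie

/-! ### The decomposition into degrees -/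

/-- A linear left inverse of the inclusion of the Schwartz functions into `L²(ℝⁿ)`. -/
def l2ToSchwartz (n : ℕ) : L2 n →ₗ[ℂ] 𝓢(EuclideanSpace ℝ (Fin n), ℂ) :=
  (LinearMap.exists_leftInverse_of_injective (schwartzToL2 n)
    (LinearMap.ker_eq_bot.mpr (schwartzToL2_injective n))).choose

theorem l2ToSchwartz_schwartzToL2 (f : 𝓢(EuclideanSpace ℝ (Fin n), ℂ)) :
    l2ToSchwartz n (schwartzToL2 n f) = f :=
  LinearMap.congr_fun (LinearMap.exists_leftInverse_of_injective (schwartzToL2 n)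
    (LinearMap.ker_eq_bot.mpr (schwartzToL2_injective n))).choose_spec f

theorem schwartzToL2_mem_hermiteSpan {l : ℤ} {f : 𝓢(EuclideanSpace ℝ (Fin n), ℂ)}
    (hf : f ∈ hermiteSchwartzSpan n l) : schwartzToL2 n f ∈ hermiteSpan n l := by
  rw [hermiteSpan_eq_map]
  exact Submodule.mem_map_of_mem hf

theorem l2ToSchwartz_mem {l : ℤ} {f : L2 n} (hf : f ∈ hermiteSpan n l) :
    l2ToSchwartz n f ∈ hermiteSchwartzSpan n l := by
  rw [hermiteSpan_eq_map] at hf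
  obtain ⟨g, hg, rfl⟩ := hf
  rwa [l2ToSchwartz_schwartzToL2]

/-- The left inverse is arbitrary off the Schwartz functions, but Hermite spans lie in their image,
where it is a genuine inverse. -/
theorem schwartzToL2_l2ToSchwartz {l : ℤ} {f : L2 n} (hf : f ∈ hermiteSpan n l) :
    schwartzToL2 n (l2ToSchwartz n f) = f := by
  rw [hermiteSpan_eq_map] at hf
  obtain ⟨g, hg, rfl⟩ := hf
  rw [l2ToSchwartz_schwartzToL2]

/-- The spectral projection of the harmonic oscillator that separates the degrees `l - 1` and
`l + 1`. -/
def upperPart (n : ℕ) (l : ℤ) :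
    𝓢(EuclideanSpace ℝ (Fin n), ℂ) →ₗ[ℂ] 𝓢(EuclideanSpace ℝ (Fin n), ℂ) :=
  (1 / 4 : ℂ) • (oscillator n - (2 * ((l - 1 : ℤ) : ℂ) + n) • LinearMap.id)

theorem upperPart_apply (l : ℤ) (f : 𝓢(EuclideanSpace ℝ (Fin n), ℂ)) :
    upperPart n l f = (1 / 4 : ℂ) • (oscillator n f - (2 * ((l - 1 : ℤ) : ℂ) + n) • f) :=
  rfl

/-- The eigenvalues in degrees `l - 1` and `l + 1` differ by `4`, so the operator kills the lower
part and fixes the upper one. -/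
theorem upperPart_mem {l : ℤ} {f : 𝓢(EuclideanSpace ℝ (Fin n), ℂ)}
    (hf : f ∈ hermiteSchwartzSpan n (l - 1) ⊔ hermiteSchwartzSpan n (l + 1)) :
    upperPart n l f ∈ hermiteSchwartzSpan n (l + 1) ∧
      f - upperPart n l f ∈ hermiteSchwartzSpan n (l - 1) := by
  obtain ⟨f₁, h₁, f₂, h₂, rfl⟩ := Submodule.mem_sup.mp hf
  have h : upperPart n l (f₁ + f₂) = f₂ := by
    rw [upperPart_apply, map_add, oscillator_of_mem h₁, oscillator_of_mem h₂]
    match_scalars <;> ring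
  rw [h, add_sub_cancel_right]
  exact ⟨h₂, h₁⟩

/-- A bilinear contraction with `B` is unchanged when `A` acts on both indices. It is applied with
`B = J` and `A` the isotropy matrix. -/
theorem sum_smul_of_mul_mul_transpose {ι W : Type*} [Fintype ι] [AddCommGroup W] [Module ℂ W]
    {A B : Matrix ι ι ℝ} (h : A * B * Aᵀ = B) (T : ι → ι → W) :
    ∑ a, ∑ b, (B a b : ℂ) • ∑ c, (A c a : ℂ) • ∑ d, (A d b : ℂ) • T c d =
      ∑ c, ∑ d, (B c d : ℂ) • T c d := by
  have hB : ∀ c d, (B c d : ℂ) = ∑ b, ∑ a, (B a b : ℂ) * ((A c a : ℂ) * (A d b : ℂ)) := by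
    intro c d
    have h1 := congrFun (congrFun h c) d
    rw [← h1]
    simp only [Matrix.mul_apply, Matrix.transpose_apply, Finset.sum_mul]
    push_cast
    exact Finset.sum_congr rfl fun b _ => Finset.sum_congr rfl fun a _ => by ring
  simp only [Finset.smul_sum, smul_smul]
  have h2 : ∀ c d, (B c d : ℂ) • T c d =
      ∑ b, ∑ a, ((B a b : ℂ) * ((A c a : ℂ) * (A d b : ℂ))) • T c d := by
    intro c d
    simp only [← Finset.sum_smul]
    rw [← hB]
  simp only [h2]
  calc _ = ∑ a, ∑ c, ∑ b, ∑ d, ((B a b : ℂ) * ((A c a : ℂ) * (A d b : ℂ))) • T c d :=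
        Finset.sum_congr rfl fun a _ => Finset.sum_comm
    _ = ∑ c, ∑ a, ∑ b, ∑ d, ((B a b : ℂ) * ((A c a : ℂ) * (A d b : ℂ))) • T c d :=
        Finset.sum_comm
    _ = _ := by
        refine Finset.sum_congr rfl fun c _ => ?_
        calc _ = ∑ a, ∑ d, ∑ b, ((B a b : ℂ) * ((A c a : ℂ) * (A d b : ℂ))) • T c d :=
              Finset.sum_congr rfl fun a _ => Finset.sum_comm
          _ = ∑ d, ∑ a, ∑ b, ((B a b : ℂ) * ((A c a : ℂ) * (A d b : ℂ))) • T c d :=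
              Finset.sum_comm
          _ = _ := Finset.sum_congr rfl fun d _ => Finset.sum_comm

namespace HermitianSymmetric

variable {E : Type*} [NormedAddCommGroup E] [NormedSpace ℝ E]
  {G : Type*} [TopologicalSpace G] [ChartedSpace E G] [Group G]
  {S : HermitianSymmetric E G n}

/-! ### The isotropy representation is unitary -/

theorem J₀_X_inr (j : Fin n) : S.J₀ (S.X (Sum.inr j)) = -S.X (Sum.inl j) := by
  rw [← S.J₀_X, S.J₀_sq]

theorem J₀_equivFun_symm (z : Fin n ⊕ Fin n → ℝ) :
    S.J₀ (S.X.equivFun.symm z) = S.X.equivFun.symm (Matrix.J (Fin n) ℝ *ᵥ z) := by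
  rw [Module.Basis.equivFun_symm_apply, Module.Basis.equivFun_symm_apply, map_sum]
  have h : ∀ j, (Matrix.J (Fin n) ℝ *ᵥ z) (Sum.inl j) = -z (Sum.inr j) := by
    intro j
    simp [Matrix.J, Matrix.fromBlocks_mulVec, Matrix.neg_mulVec]
  have h' : ∀ j, (Matrix.J (Fin n) ℝ *ᵥ z) (Sum.inr j) = z (Sum.inl j) := by
    intro j
    simp [Matrix.J, Matrix.fromBlocks_mulVec]
  simp only [map_smul, Fintype.sum_sum_type, J₀_X_inr, S.J₀_X]
  simp only [h, h', smul_neg, neg_smul]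
  rw [add_comm]

/-- The matrix of the isotropy representation. -/
def Lift.mat (κ : S.Lift) (h : S.H) : Matrix (Fin n ⊕ Fin n) (Fin n ⊕ Fin n) ℝ :=
  (rho n (κ.hom h)).1

variable (κ : S.Lift)

/-- In a unitary basis `J₀` has matrix `J`, so invariance of `J₀` is commutation of matrices. -/
theorem Lift.mat_mul_J (h : S.H) :
    κ.mat h * Matrix.J (Fin n) ℝ = Matrix.J (Fin n) ℝ * κ.mat h := by
  refine Matrix.ext_of_mulVec_single fun a => ?_
  set z : Fin n ⊕ Fin n → ℝ := Pi.single a 1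
  have h1 := S.J₀_invariant h h.2 _ _ (κ.rho_hom h z)
  rw [J₀_equivFun_symm, J₀_equivFun_symm, ← κ.rho_hom h] at h1
  have h2 := S.X.equivFun.symm.injective (Subtype.ext h1)
  rw [← Matrix.mulVec_mulVec, ← Matrix.mulVec_mulVec]
  exact h2.symm

theorem Lift.mat_symplectic (h : S.H) :
    κ.mat h * Matrix.J (Fin n) ℝ * (κ.mat h)ᵀ = Matrix.J (Fin n) ℝ :=
  SymplecticGroup.mem_iff.mp (rho n (κ.hom h)).2

/-- Moving `J` to the left in `A J Aᵀ = J` gives `J A Aᵀ = J`, and `J² = -1` cancels `J`. -/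
theorem Lift.mat_mul_transpose (h : S.H) : κ.mat h * (κ.mat h)ᵀ = 1 := by
  have h1 := κ.mat_symplectic h
  rw [κ.mat_mul_J, Matrix.mul_assoc] at h1
  have h2 := congrArg (Matrix.J (Fin n) ℝ * ·) h1
  simp only [← Matrix.mul_assoc, Matrix.J_squared] at h2
  rw [Matrix.mul_assoc] at h2
  simpa using h2

theorem Lift.Ad_X (h : S.H) (b : Fin n ⊕ Fin n) :
    Ad E (h : G) (S.X b : GroupLieAlgebra 𝓘(ℝ, E) G) =
      ∑ d, κ.mat h d b • (S.X d : GroupLieAlgebra 𝓘(ℝ, E) G) := by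
  have h1 := κ.rho_hom h (Pi.single b 1)
  rw [Module.Basis.equivFun_symm_apply, Module.Basis.equivFun_symm_apply] at h1
  have h2 : ∑ i, (Pi.single b 1 : Fin n ⊕ Fin n → ℝ) i • S.X i = S.X b := by
    rw [Finset.sum_eq_single b] <;> simp +contextual
  rw [h2] at h1
  rw [← h1]
  simp [Lift.mat, -Fintype.sum_sum_type]

/-! ### Equivariance of the Clifford operators -/

theorem Lift.lam_cliffSchwartz {h : S.H} {f g : 𝓢(EuclideanSpace ℝ (Fin n), ℂ)}
    (hfg : κ.lam h (schwartzToL2 n f) = schwartzToL2 n g) (c : Fin n ⊕ Fin n) :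
    κ.lam h (schwartzToL2 n (cliffSchwartz n c f)) =
      schwartzToL2 n (∑ b, (κ.mat h b c : ℂ) • cliffSchwartz n b g) :=
  Mpc_cliffSchwartz (Mp_le_Mpc n (κ.hom h).2) hfg c

theorem Lift.lam_oscillator {h : S.H} {f g : 𝓢(EuclideanSpace ℝ (Fin n), ℂ)}
    (hfg : κ.lam h (schwartzToL2 n f) = schwartzToL2 n g) :
    κ.lam h (schwartzToL2 n (oscillator n f)) = schwartzToL2 n (oscillator n g) :=
  Mpc_oscillator (Mp_le_Mpc n (κ.hom h).2) (κ.mat_mul_transpose h) hfg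

variable {V : Type*} [NormedAddCommGroup V] [NormedSpace ℂ V] (τ : Representation ℂ G V)

/-- The `H`-equivariant linear maps from `V` to `L²(ℝⁿ)` that take values in the Schwartz space. -/
def Lift.schwartzHom : Submodule ℂ (V →ₗ[ℂ] 𝓢(EuclideanSpace ℝ (Fin n), ℂ)) where
  carrier := {M | ∀ (h : S.H) (v : V),
    κ.lam h (schwartzToL2 n (M v)) = schwartzToL2 n (M (τ (h : G) v))}
  zero_mem' := fun h v => by simp
  add_mem' := fun {M N} hM hN h v => by
    simp only [LinearMap.add_apply, map_add (schwartzToL2 n), map_add (κ.lam h), hM h v, hN h v]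
  smul_mem' := fun c M hM h v => by
    simp only [LinearMap.smul_apply, map_smul (schwartzToL2 n), map_smul (κ.lam h), hM h v]

variable {τ}

theorem Lift.oscillator_comp_mem {M : V →ₗ[ℂ] 𝓢(EuclideanSpace ℝ (Fin n), ℂ)}
    (hM : M ∈ κ.schwartzHom τ) : oscillator n ∘ₗ M ∈ κ.schwartzHom τ :=
  fun h v => κ.lam_oscillator (hM h v)

/-- The projection is a polynomial in the oscillator, which commutes with `λ(h)`; hence each
homogeneous part of an equivariant map is equivariant. -/
theorem Lift.upperPart_comp_mem (l : ℤ) {M : V →ₗ[ℂ] 𝓢(EuclideanSpace ℝ (Fin n), ℂ)}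
    (hM : M ∈ κ.schwartzHom τ) : upperPart n l ∘ₗ M ∈ κ.schwartzHom τ := by
  have h : upperPart n l ∘ₗ M =
      (1 / 4 : ℂ) • (oscillator n ∘ₗ M - (2 * ((l - 1 : ℤ) : ℂ) + n) • M) := by
    ext1 v
    exact upperPart_apply l (M v)
  rw [h]
  exact Submodule.smul_mem _ _
    (Submodule.sub_mem _ (κ.oscillator_comp_mem hM) (Submodule.smul_mem _ _ hM))

theorem Lift.schwartzToL2_comp_mem_homH {l : ℤ} {M : V →ₗ[ℂ] 𝓢(EuclideanSpace ℝ (Fin n), ℂ)}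
    (hM : M ∈ κ.schwartzHom τ) (hl : ∀ v, M v ∈ hermiteSchwartzSpan n l) :
    schwartzToL2 n ∘ₗ M ∈ κ.homH τ l :=
  ⟨fun v => schwartzToL2_mem_hermiteSpan (hl v), fun h v => (hM h v).symm⟩

theorem Lift.l2ToSchwartz_comp_mem {l : ℤ} {L : V →ₗ[ℂ] L2 n} (hL : L ∈ κ.homH τ l) :
    l2ToSchwartz n ∘ₗ L ∈ κ.schwartzHom τ := by
  intro h v
  change κ.lam h (schwartzToL2 n (l2ToSchwartz n (L v))) =
    schwartzToL2 n (l2ToSchwartz n (L (τ (h : G) v)))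
  rw [schwartzToL2_l2ToSchwartz (hL.1 v), schwartzToL2_l2ToSchwartz (hL.1 _), hL.2 h v]

/-- Negative degrees contribute only zero; this covers the target degree `l - 1` when `l = 0`. -/
theorem Lift.homH_le_homSum (l : ℤ) : κ.homH τ l ≤ κ.homSum τ := by
  by_cases hl : 0 ≤ l
  · obtain ⟨k, rfl⟩ := Int.eq_ofNat_of_zero_le hl
    exact le_iSup (fun k : ℕ => κ.homH τ (k : ℤ)) k
  · intro L hL
    have h0 : L = 0 := by
      ext1 v
      have h1 := hL.1 v
      rw [hermiteSpan_eq_map, hermiteSchwartzSpan_of_neg (not_le.mp hl), Submodule.map_bot] at h1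
      exact (Submodule.mem_bot ℂ).mp h1
    rw [h0]
    exact Submodule.zero_mem _

/-- Composition with the oscillator, transported to `L²(ℝⁿ)` by the left inverse, acts on the `l`-th
space by `2l + n`; eigenspaces for distinct eigenvalues are independent. -/
theorem Lift.iSupIndep_homH : iSupIndep (fun l : ℕ => κ.homH τ (l : ℤ)) := by
  let Ψ : Module.End ℂ (V →ₗ[ℂ] L2 n) :=
    LinearMap.llcomp ℂ V (L2 n) (L2 n) (schwartzToL2 n ∘ₗ oscillator n ∘ₗ l2ToSchwartz n)
  have h1 : Function.Injective (fun l : ℕ => (2 * (l : ℂ) + n)) := by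
    intro a b hab
    simpa using hab
  refine ((Module.End.eigenspaces_iSupIndep Ψ).comp h1).mono fun l L hL => ?_
  refine Module.End.mem_eigenspace_iff.mpr (LinearMap.ext fun v => ?_)
  change schwartzToL2 n (oscillator n (l2ToSchwartz n (L v))) = (2 * (l : ℂ) + n) • L v
  rw [oscillator_of_mem (l2ToSchwartz_mem (hL.1 v)), map_smul, schwartzToL2_l2ToSchwartz (hL.1 v)]
  rfl

/-! ### The operator `D_V` -/

variable (S) in
/-- The operator `M ↦ -∑ Xⱼ · M ∘ τ_*(X_{n+j}) + ∑ X_{n+j} · M ∘ τ_*(Xⱼ)` on linear maps from `V`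
to the Schwartz space. -/
def diracSchwartz (hτ : ∀ v, ContMDiff 𝓘(ℝ, E) 𝓘(ℝ, V) ∞ fun g : G => τ g v)
    (M : V →ₗ[ℂ] 𝓢(EuclideanSpace ℝ (Fin n), ℂ)) :
    V →ₗ[ℂ] 𝓢(EuclideanSpace ℝ (Fin n), ℂ) :=
  ∑ a, ∑ b, (Matrix.J (Fin n) ℝ a b : ℂ) •
    (cliffSchwartz n a ∘ₗ M ∘ₗ dRepHom τ hτ (S.X b : GroupLieAlgebra 𝓘(ℝ, E) G))

variable (hτ : ∀ v, ContMDiff 𝓘(ℝ, E) 𝓘(ℝ, V) ∞ fun g : G => τ g v)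

theorem diracSchwartz_apply (M : V →ₗ[ℂ] 𝓢(EuclideanSpace ℝ (Fin n), ℂ)) (v : V) :
    S.diracSchwartz hτ M v = ∑ a, ∑ b, (Matrix.J (Fin n) ℝ a b : ℂ) •
      cliffSchwartz n a (M (dRep E τ (S.X b : GroupLieAlgebra 𝓘(ℝ, E) G) v)) := by
  simp only [diracSchwartz, LinearMap.sum_apply]
  rfl

/-- The nonzero entries of `J` are `-1` at `(j, n+j)` and `1` at `(n+j, j)`. The contracted form
displays the symplectic invariance, this one the formula of the theorem. -/
theorem diracSchwartz_apply' (M : V →ₗ[ℂ] 𝓢(EuclideanSpace ℝ (Fin n), ℂ)) (v : V) :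
    S.diracSchwartz hτ M v =
      -(∑ j, cliffSchwartz n (Sum.inl j)
          (M (dRep E τ (S.X (Sum.inr j) : GroupLieAlgebra 𝓘(ℝ, E) G) v)))
      + ∑ j, cliffSchwartz n (Sum.inr j)
          (M (dRep E τ (S.X (Sum.inl j) : GroupLieAlgebra 𝓘(ℝ, E) G) v)) := by
  rw [diracSchwartz_apply]
  simp only [Fintype.sum_sum_type, Matrix.J, Matrix.fromBlocks_apply₁₁, Matrix.fromBlocks_apply₁₂,
    Matrix.fromBlocks_apply₂₁, Matrix.fromBlocks_apply₂₂, Matrix.zero_apply, Matrix.neg_apply,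
    Matrix.one_apply, Complex.ofReal_zero, zero_smul, Finset.sum_const_zero, zero_add, add_zero]
  congr 1
  · rw [← Finset.sum_neg_distrib]
    refine Finset.sum_congr rfl fun j _ => ?_
    rw [Finset.sum_eq_single j] <;> simp +contextual [eq_comm]
  · refine Finset.sum_congr rfl fun j _ => ?_
    rw [Finset.sum_eq_single j] <;> simp +contextual [eq_comm]

theorem diracSchwartz_mem {l : ℤ} {M : V →ₗ[ℂ] 𝓢(EuclideanSpace ℝ (Fin n), ℂ)}
    (hM : ∀ v, M v ∈ hermiteSchwartzSpan n l) (v : V) :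
    S.diracSchwartz hτ M v ∈
      hermiteSchwartzSpan n (l - 1) ⊔ hermiteSchwartzSpan n (l + 1) := by
  rw [diracSchwartz_apply]
  exact Submodule.sum_mem _ fun a _ => Submodule.sum_mem _ fun b _ =>
    Submodule.smul_mem _ _ (cliffSchwartz_mem a l (hM _))

/-- Clifford multiplication and `τ_*` both transform by the isotropy matrix `A`, so invariance of
the contraction is `A J Aᵀ = J`. -/
theorem Lift.diracSchwartz_mem_schwartzHom [LieGroup 𝓘(ℝ, E) ∞ G] [FiniteDimensional ℂ V]
    {M : V →ₗ[ℂ] 𝓢(EuclideanSpace ℝ (Fin n), ℂ)}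
    (hM : M ∈ κ.schwartzHom τ) : S.diracSchwartz hτ M ∈ κ.schwartzHom τ := by
  intro h v
  have h1 : ∀ b, τ (h : G) (dRep E τ (S.X b : GroupLieAlgebra 𝓘(ℝ, E) G) v) =
      ∑ d, (κ.mat h d b : ℂ) •
        dRep E τ (S.X d : GroupLieAlgebra 𝓘(ℝ, E) G) (τ (h : G) v) := by
    intro b
    rw [rep_dRep τ hτ, κ.Ad_X, dRep_sum_left]
    refine Finset.sum_congr rfl fun d _ => ?_
    rw [dRep_smul_left, Complex.coe_smul]
  rw [diracSchwartz_apply, diracSchwartz_apply]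
  rw [← sum_smul_of_mul_mul_transpose (κ.mat_symplectic h)
    fun c d => cliffSchwartz n c (M (dRep E τ (S.X d : GroupLieAlgebra 𝓘(ℝ, E) G) (τ (h : G) v)))]
  simp only [map_sum (schwartzToL2 n), map_sum (κ.lam h), map_smul (schwartzToL2 n),
    map_smul (κ.lam h)]
  refine Finset.sum_congr rfl fun a _ => Finset.sum_congr rfl fun b _ => congrArg _ ?_
  rw [κ.lam_cliffSchwartz (hM h _), h1]
  simp only [map_sum, map_smul]

/-- The operator `D_V` on linear maps from `V` to `L²(ℝⁿ)`. -/
def diracHom (S : HermitianSymmetric E G n)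
    (hτ : ∀ v, ContMDiff 𝓘(ℝ, E) 𝓘(ℝ, V) ∞ fun g : G => τ g v) :
    (V →ₗ[ℂ] L2 n) →ₗ[ℂ] (V →ₗ[ℂ] L2 n) where
  -- For general `L` the value depends on the chosen left inverse; it has its intended meaning on
  -- `U`.
  toFun L := schwartzToL2 n ∘ₗ S.diracSchwartz hτ (l2ToSchwartz n ∘ₗ L)
  map_add' L M := by
    rw [← LinearMap.comp_add]
    congr 1
    ext1 v
    simp only [diracSchwartz_apply, LinearMap.add_apply, LinearMap.comp_apply, map_add, smul_add,
      Finset.sum_add_distrib]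
  map_smul' c L := by
    rw [RingHom.id_apply, ← LinearMap.comp_smul]
    congr 1
    ext1 v
    simp only [diracSchwartz_apply, LinearMap.smul_apply, LinearMap.comp_apply, map_smul,
      Finset.smul_sum, smul_comm c]

theorem Lift.diracHom_mem_sup [LieGroup 𝓘(ℝ, E) ∞ G] [FiniteDimensional ℂ V] {l : ℤ}
    {L : V →ₗ[ℂ] L2 n} (hL : L ∈ κ.homH τ l) :
    S.diracHom hτ L ∈ κ.homH τ (l - 1) ⊔ κ.homH τ (l + 1) := by
  set N := S.diracSchwartz hτ (l2ToSchwartz n ∘ₗ L)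
  have hN : N ∈ κ.schwartzHom τ := κ.diracSchwartz_mem_schwartzHom hτ (κ.l2ToSchwartz_comp_mem hL)
  have hNl := diracSchwartz_mem (S := S) hτ (M := l2ToSchwartz n ∘ₗ L)
    fun v => l2ToSchwartz_mem (hL.1 v)
  have h1 : S.diracHom hτ L = schwartzToL2 n ∘ₗ (N - upperPart n l ∘ₗ N) +
      schwartzToL2 n ∘ₗ (upperPart n l ∘ₗ N) := by
    rw [← LinearMap.comp_add, sub_add_cancel]
    rfl
  rw [h1]
  have hU := κ.upperPart_comp_mem l hN
  exact Submodule.add_mem_sup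
    (κ.schwartzToL2_comp_mem_homH ((κ.schwartzHom τ).sub_mem hN hU)
      fun v => (upperPart_mem (hNl v)).2)
    (κ.schwartzToL2_comp_mem_homH hU fun v => (upperPart_mem (hNl v)).1)

theorem Lift.diracHom_mem_homSum [LieGroup 𝓘(ℝ, E) ∞ G] [FiniteDimensional ℂ V]
    {L : V →ₗ[ℂ] L2 n}
    (hL : L ∈ κ.homSum τ) : S.diracHom hτ L ∈ κ.homSum τ := by
  suffices h : κ.homSum τ ≤ (κ.homSum τ).comap (S.diracHom hτ) from h hL
  refine iSup_le fun l L hL => ?_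
  exact sup_le (κ.homH_le_homSum _) (κ.homH_le_homSum _) (κ.diracHom_mem_sup hτ hL)

theorem Lift.schwartzToL2_l2ToSchwartz_apply {L : V →ₗ[ℂ] L2 n}
    (hL : L ∈ κ.homSum τ) (v : V) : schwartzToL2 n (l2ToSchwartz n (L v)) = L v := by
  induction hL using Submodule.iSup_induction' with
  | mem l L hL => exact schwartzToL2_l2ToSchwartz (hL.1 v)
  | zero => simp
  | add L M _ _ hL hM => simp only [LinearMap.add_apply, map_add, hL, hM]

theorem cliff_X (a : Fin n ⊕ Fin n) (f : L2 n) : S.cliff (S.X a) f = cliffBasis n a f := by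
  rw [cliff, Module.Basis.constr_basis]
  rfl

theorem Lift.toDistr_diracHom {L : V →ₗ[ℂ] L2 n} (hL : L ∈ κ.homSum τ) (v : V) :
    toDistr n (S.diracHom hτ L v) =
      -(∑ j : Fin n, S.cliff (S.X (Sum.inl j)) (L (dRep E τ (S.X (Sum.inr j)) v)))
      + ∑ j : Fin n, S.cliff (S.X (Sum.inr j)) (L (dRep E τ (S.X (Sum.inl j)) v)) := by
  have h1 : ∀ a w, S.cliff (S.X a) (L w) =
      toDistr n (schwartzToL2 n (cliffSchwartz n a (l2ToSchwartz n (L w)))) := by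
    intro a w
    rw [cliff_X, ← cliffBasis_schwartzToL2, κ.schwartzToL2_l2ToSchwartz_apply hL]
  simp only [h1]
  change toDistr n (schwartzToL2 n (S.diracSchwartz hτ (l2ToSchwartz n ∘ₗ L) v)) = _
  rw [diracSchwartz_apply']
  simp only [map_add, map_neg, map_sum]
  rfl

/-! ### The Dirac operator on spinor fields -/

theorem omegaBar_eq {α : Module.Dual ℝ S.m} {Y : S.m} (h : ∀ a, S.ω₀ Y (S.X a) = α (S.X a)) :
    S.omegaBar α = Y := by
  have : FiniteDimensional ℝ S.m := S.X.finiteDimensional_of_finite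
  refine (LinearEquiv.symm_apply_eq _).mpr (S.X.ext fun a => ?_)
  rw [LinearMap.BilinForm.toDual_def, h]

theorem omegaBar_coord_inr (j : Fin n) :
    S.omegaBar (S.X.coord (Sum.inr j)) = S.X (Sum.inl j) := by
  refine omegaBar_eq fun a => ?_
  rcases a with k | k
  · simp [S.ω₀_inl_inl]
  · simp [S.ω₀_inl_inr, Finsupp.single_apply, eq_comm]

/-- The sign comes from `ω₀(X_{n+j}, X_k) = -δ_jk`, as `ω₀` is alternating. -/
theorem omegaBar_coord_inl (j : Fin n) :
    S.omegaBar (S.X.coord (Sum.inl j)) = -S.X (Sum.inr j) := by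
  refine omegaBar_eq fun a => ?_
  rcases a with k | k
  · rw [map_neg, LinearMap.neg_apply, LinearMap.BilinForm.IsAlt.neg_eq S.ω₀_alt, S.ω₀_inl_inr]
    simp [Finsupp.single_apply]
  · simp [S.ω₀_inr_inr]

/-- Write `∇φ` as the sum of `X_a* ⊗ ∇_{X_a}φ` and insert the values of `ω̄` on the dual basis. -/
theorem diracDistr_eq (φ : G → L2 n) (g : G) :
    S.diracDistr φ g =
      ∑ j, S.cliff (S.X (Sum.inl j)) (S.nabla φ g (S.X (Sum.inr j))) -
      ∑ j, S.cliff (S.X (Sum.inr j)) (S.nabla φ g (S.X (Sum.inl j))) := by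
  have : FiniteDimensional ℝ S.m := S.X.finiteDimensional_of_finite
  have h1 : (dualTensorHomEquiv ℝ S.m (L2 n)).symm (S.nabla φ g) =
      ∑ a, S.X.coord a ⊗ₜ[ℝ] S.nabla φ g (S.X a) := by
    refine (LinearEquiv.symm_apply_eq _).mpr (S.X.ext fun b => ?_)
    change _ = dualTensorHom ℝ S.m (L2 n) (∑ a, S.X.coord a ⊗ₜ[ℝ] S.nabla φ g (S.X a)) (S.X b)
    rw [map_sum, LinearMap.sum_apply, Finset.sum_eq_single b]
    · simp [dualTensorHom_apply]
    · intro a _ ha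
      simp [dualTensorHom_apply, ha.symm]
    · simp
  rw [diracDistr, h1, map_sum, map_sum]
  simp only [LinearMap.rTensor_tmul, TensorProduct.lift.tmul, LinearEquiv.coe_coe,
    Fintype.sum_sum_type, omegaBar_coord_inl, omegaBar_coord_inr, map_neg, LinearMap.neg_apply,
    Finset.sum_neg_distrib]
  abel

theorem Lift.spinorFields_mdifferentiable (φ : κ.spinorFields) (g : G) :
    MDifferentiableAt 𝓘(ℝ, E) 𝓘(ℝ, L2 n) φ.1 g :=
  φ.2.1.mdifferentiable (by simp) g

theorem Lift.IsDirac.add {κ : S.Lift} {φ φ' ψ ψ' : κ.spinorFields} (h : κ.IsDirac φ ψ)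
    (h' : κ.IsDirac φ' ψ') : κ.IsDirac (φ + φ') (ψ + ψ') := by
  intro g
  have h1 : S.nabla (φ + φ').1 g = S.nabla φ.1 g + S.nabla φ'.1 g := by
    ext1 Y
    have h2 := mfderiv_add (κ.spinorFields_mdifferentiable φ g)
      (κ.spinorFields_mdifferentiable φ' g)
    exact congrArg (fun T : E →L[ℝ] L2 n =>
      T (mulInvariantVectorField (Y : GroupLieAlgebra 𝓘(ℝ, E) G) g)) h2
  have h2 : S.diracDistr (φ + φ').1 g = S.diracDistr φ.1 g + S.diracDistr φ'.1 g := by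
    simp only [diracDistr, h1, map_add]
  rw [h2, h g, h' g, ← map_add]
  rfl

theorem Lift.isDirac_zero : κ.IsDirac 0 0 := by
  intro g
  have h1 : S.nabla (0 : κ.spinorFields).1 g = 0 := by
    ext1 Y
    have h2 : mfderiv 𝓘(ℝ, E) 𝓘(ℝ, L2 n) (fun _ : G => (0 : L2 n)) g = 0 := mfderiv_const
    exact congrArg (fun T : E →L[ℝ] L2 n =>
      T (mulInvariantVectorField (Y : GroupLieAlgebra 𝓘(ℝ, E) G) g)) h2
  simp only [diracDistr, h1, map_zero]
  exact (map_zero (toDistr n)).symm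

variable [LieGroup 𝓘(ℝ, E) ∞ G] [FiniteDimensional ℂ V]

theorem nabla_embed (hτ : ∀ v, ContMDiff 𝓘(ℝ, E) 𝓘(ℝ, V) ∞ fun g : G => τ g v)
    (L : V →ₗ[ℂ] L2 n) (v : V) (g : G) (Y : S.m) :
    S.nabla (fun g : G => L (τ g⁻¹ v)) g Y =
      -L (dRep E τ (Y : GroupLieAlgebra 𝓘(ℝ, E) G) (τ g⁻¹ v)) := by
  have hF : MDifferentiable 𝓘(ℝ, E) 𝓘(ℝ, V) (fun x : G => τ x⁻¹ v) :=
    ((hτ v).comp (contMDiff_inv 𝓘(ℝ, E) ∞)).mdifferentiable (by simp)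
  have h1 := mfderiv_clm_comp ((LinearMap.toContinuousLinearMap L).restrictScalars ℝ) (hF g)
    (mulInvariantVectorField (Y : GroupLieAlgebra 𝓘(ℝ, E) G) g)
  have h2 := mfderiv_rep_inv τ hτ g (Y : GroupLieAlgebra 𝓘(ℝ, E) G) v
  exact h1.trans ((congrArg L h2).trans (map_neg L _))

/-- The restriction of `D_V` to `U`. -/
def Lift.diracSum : κ.homSum τ →ₗ[ℂ] κ.homSum τ :=
  (S.diracHom hτ).restrict fun _ hL => κ.diracHom_mem_homSum hτ hL

theorem Lift.isDirac_embed (t : V ⊗[ℂ] κ.homSum τ) :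
    κ.IsDirac (κ.embed τ hτ t) (κ.embed τ hτ (LinearMap.lTensor V (κ.diracSum hτ) t)) := by
  induction t using TensorProduct.induction_on with
  | zero => simpa only [map_zero] using κ.isDirac_zero
  | add s t hs ht => simpa only [map_add] using hs.add ht
  | tmul v L =>
    intro g
    change S.diracDistr (fun g : G => L.1 (τ g⁻¹ v)) g =
      toDistr n (S.diracHom hτ L.1 (τ g⁻¹ v))
    rw [diracDistr_eq, κ.toDistr_diracHom hτ L.2]
    -- The minus sign from differentiating `τ(g⁻¹)` reverses both sums and produces the signs of
    -- `D_V`.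
    simp only [nabla_embed hτ, map_neg, Finset.sum_neg_distrib]
    abel

theorem Lift.embed_injective (hirr : τ.IsIrreducible) : Function.Injective (κ.embed τ hτ) := by
  refine (injective_iff_map_eq_zero _).mpr fun t ht => ?_
  refine tensor_eq_zero_of_isIrreducible τ hirr _ t fun g => ?_
  -- Evaluating the field at `g⁻¹` yields the contraction with `τ(g)` to which Burnside's theorem
  -- applies.
  have h1 : ∀ t : V ⊗[ℂ] κ.homSum τ, (κ.embed τ hτ t).1 g⁻¹ =
      TensorProduct.lift (LinearMap.mk₂ ℂ (fun v (L : κ.homSum τ) => L.1 (τ g v))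
        (by simp) (by simp) (by simp) (by simp)) t := by
    intro t
    induction t using TensorProduct.induction_on with
    | zero => simp
    | add s t hs ht =>
      rw [map_add, map_add, ← hs, ← ht]
      rfl
    | tmul v L =>
      change L.1 (τ g⁻¹⁻¹ v) = L.1 (τ g v)
      rw [inv_inv]
  rw [← h1, ht]
  rfl

end HermitianSymmetric

end SympDirac

end

theorem mainTheorem1
    {E : Type*} [NormedAddCommGroup E] [NormedSpace ℝ E] [FiniteDimensional ℝ E]
    {G : Type*} [TopologicalSpace G] [T2Space G] [CompactSpace G] [SimplyConnectedSpace G]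
    [ChartedSpace E G] [Group G] [LieGroup 𝓘(ℝ, E) ∞ G]
    {n : ℕ} (S : SympDirac.HermitianSymmetric E G n) (κ : S.Lift)
    {V : Type*} [NormedAddCommGroup V] [NormedSpace ℂ V] [FiniteDimensional ℂ V]
    (τ : Representation ℂ G V) (hirr : τ.IsIrreducible)
    (hτ : ∀ v, ContMDiff 𝓘(ℝ, E) 𝓘(ℝ, V) ∞ fun g : G => τ g v) :
    -- the sum of the spaces `Hom_H(V, W_l)` is direct
    iSupIndep (fun l : ℕ => κ.homH τ (l : ℤ)) ∧
    -- `V ⊗ U` is embedded in the spinor fields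
    Function.Injective (κ.embed τ hτ) ∧
    ∃ Da : κ.homSum τ →ₗ[ℂ] κ.homSum τ,
      -- the Clifford-type formula for `D_a`
      (∀ (L : κ.homSum τ) (v : V),
        SympDirac.toDistr n ((Da L).1 v) =
          -(∑ j : Fin n, S.cliff (S.X (Sum.inl j)) (L.1 (SympDirac.dRep E τ (S.X (Sum.inr j)) v)))
          + ∑ j : Fin n, S.cliff (S.X (Sum.inr j))
              (L.1 (SympDirac.dRep E τ (S.X (Sum.inl j)) v))) ∧
      -- `D_a` raises or lowers the degree by one
      (∀ (l : ℕ) (L : κ.homSum τ), L.1 ∈ κ.homH τ (l : ℤ) →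
        (Da L).1 ∈ κ.homH τ ((l : ℤ) - 1) ⊔ κ.homH τ ((l : ℤ) + 1)) ∧
      -- on `V ⊗ U` the Dirac operator is `id ⊗ D_a`
      (∀ t : V ⊗[ℂ] κ.homSum τ,
        κ.IsDirac (κ.embed τ hτ t) (κ.embed τ hτ (LinearMap.lTensor V Da t))) ∧
      -- the image of `V ⊗ U` is invariant under the Dirac operator
      (∀ φ ∈ LinearMap.range (κ.embed τ hτ),
        ∃ ψ ∈ LinearMap.range (κ.embed τ hτ), κ.IsDirac φ ψ) := by
  refine ⟨κ.iSupIndep_homH, κ.embed_injective hτ hirr, κ.diracSum hτ,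
    fun L v => κ.toDistr_diracHom hτ L.2 v, fun l L hL => κ.diracHom_mem_sup hτ hL,
    κ.isDirac_embed hτ, ?_⟩
  rintro _ ⟨t, rfl⟩
  exact ⟨_, ⟨_, rfl⟩, κ.isDirac_embed hτ t⟩
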